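/- \textbf{Theorem (type $D_\ell$, $\ell$ even).} Let $\ell\ge 4$ be even and let $\Phi$ be a root system of type $D_\ell$ with simple roots $\alpha_1,\dots,\alpha_\ell$, numbered so that $\alpha_1,\dots,\alpha_{\ell-2}$ form a chain in the Dynkin diagram and $\alpha_{\ell-2}$ is joined to both $\alpha_{\ell-1}$ and $\alpha_\ell$. Let $W$ be the Weyl group of $\Phi$ and let $Z=\{x : (\beta,x)\in\mathbb Z \text{ for all } \beta\in\Phi\}$ be the coweight lattice. For a positive integer $q$ let $\pi_q:Z\to Z/qZ$ be the projection, let $$M(\Phi;q)=\{\pi_q(x) : x\in Z,\ (\beta,x)\not\equiv 0 \pmod q \text{ for all } \beta\in\Phi\}\subseteq Z/qZ,$$ on which $W$ acts by $w\cdot\pi_q(x)=\pi_q(w(x))$, and let $\chi_{\Phi,q}$ be the permutation character of this action, i.e. $\chi_{\Phi,q}(w)=\#\{y\in M(\Phi;q) : w\cdot y=y\}$. For $j\in\{1,\ell-1,\ell\}$ let $\omega_j=w_jw_0\in W$, where $w_0$ is the longest element of $W$ and $w_j$ is the longest element of the subgroup generated by the simple reflections $s_{\alpha_i}$ with $i\ne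 j$. Then for every positive integer $q$ the following hold. (1) For the identity element, $$\chi_{\Phi,q}(1)=\begin{cases}(q-1)(q-3)\cdots(q-(2\ell-3))\,(q-(\ell-1)) & \text{if } q \text{ is odd},\\ (q-2)(q-4)\cdots(q-2(\ell-2))\left(q^2-2(\ell-1)q+\frac{\ell(\ell-1)}{2}\right) & \text{if } q \text{ is even}.\end{cases}$$ (2) For $\omega_1$, $$\chi_{\Phi,q}(\omega_1)=\begin{cases}0 & \text{if } q \text{ is odd},\\ (q-2)(q-4)\cdots(q-2(\ell-2)) & \text{if } q \text{ is even}.\end{cases}$$ (3) For $\omega\in\{\omega_{\ell-1},\omega_\ell\}$, $$\chi_{\Phi,q}(\omega)=\begin{cases}0 & \text{if } \gcd(4,q)=1,\\ (q-2)(q-6)\cdots(q-2(\ell-3))\left(q-\left(\frac{3\ell}{2}-2\right)\right) & \text{if } \gcd(4,q)=2,\\ (q-4)(q-8)\cdots(q-2(\ell-2))\left(q-\frac{\ell}{2}\right) & \text{if } \gcd(4,q)=4.\end{cases}$$ In (1) and (2) consecutive linear factors in the products written with dots differ by $2$, in (3) they differ by $4$. -/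

import Mathlib

noncomputable section

namespace WeylChar

/-! ### Word length and longest elements -/

section Longest

variable {G : Type*} [Group G]

/-- Length of `w` with respect to a set `S` of generators: the least `n` such that `w` is a product
of `n` elements of `S`. (Used only for `w` in the subgroup generated by a set `S` of involutions,
where such words exist.) -/
def wordLength (S : Set G) (w : G) : ℕ :=
  sInf {n | ∃ L : List G, (∀ s ∈ L, s ∈ S) ∧ L.length = n ∧ L.prod = w}

/-- `w` is an element of maximal length in the subgroup generated by `S`. -/
def IsLongest (S : Set G) (w : G) : Prop :=
  w ∈ Subgroup.closure S ∧ ∀ v ∈ Subgroup.closure S, wordLength S v ≤ wordLength S w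

theorem exists_isLongest [Finite G] (S : Set G) : ∃ w, IsLongest S w :=
  Set.exists_max_image (Subgroup.closure S : Set G) (wordLength S) (Set.toFinite _)
    ⟨1, one_mem _⟩

/-- The longest element of the (finite) group generated by `S`, with respect to `S`. -/
def longestElement [Finite G] (S : Set G) : G := Classical.choose (exists_isLongest S)

end Longest

/-- The permutation character of `G` on a finite `G`-set `X`: the number of fixed points. -/
def permCharacter (G X : Type*) [Group G] [MulAction G X] (g : G) : ℕ :=
  Nat.card (MulAction.fixedBy X g)

variable {ι M N : Type*} [AddCommGroup M] [Module ℝ M] [AddCommGroup N] [Module ℝ N]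

instance weylGroup_finite [Finite ι] (P : RootPairing ι ℝ M N) [P.IsRootSystem] :
    Finite P.weylGroup := by
  refine Finite.of_injective P.weylGroupToPerm fun g h hgh => ?_
  apply Subtype.ext
  apply RootPairing.Equiv.weightHom_injective P
  refine LinearEquiv.toLinearMap_injective
    (LinearMap.ext_on_range (v := P.root) RootPairing.IsRootSystem.span_root_eq_top fun i => ?_)
  have h1 := P.weylGroup_apply_root g i
  have h2 := P.weylGroup_apply_root h i
  rw [hgh] at h1
  exact h1.trans h2.symm

/-! ### Coweight lattice, the complement modulo `q`, and the action of the Weyl group -/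

/-- The coweight lattice `Z`: all `x` on which every root takes an integer value. -/
def coweightLattice (P : RootPairing ι ℝ M N) : AddSubgroup N where
  carrier := {x | ∀ i, ∃ n : ℤ, P.root' i x = n}
  zero_mem' := fun _ => ⟨0, by simp⟩
  add_mem' := fun {x y} hx hy i => by
    obtain ⟨m, hm⟩ := hx i
    obtain ⟨n, hn⟩ := hy i
    exact ⟨m + n, by rw [map_add, hm, hn]; push_cast; rfl⟩
  neg_mem' := fun {x} hx i => by
    obtain ⟨m, hm⟩ := hx i
    exact ⟨-m, by rw [map_neg, hm]; push_cast; rfl⟩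

/-- The (left) action of a Weyl group element `w` on the space `N` containing the coweight lattice.
It is contragredient to the action on `M`, see `pairing_coweightAct`; reflections in roots act by the
corresponding coreflections. -/
def coweightAct (P : RootPairing ι ℝ M N) (w : P.weylGroup) : N ≃ₗ[ℝ] N :=
  RootPairing.Equiv.coweightEquiv P P (w : P.Aut)⁻¹

theorem coweightAct_one (P : RootPairing ι ℝ M N) (x : N) : coweightAct P 1 x = x := by
  simp [coweightAct]

theorem coweightAct_mul (P : RootPairing ι ℝ M N) (v w : P.weylGroup) (x : N) :
    coweightAct P (v * w) x = coweightAct P v (coweightAct P w x) := by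
  simp [coweightAct]

theorem coweightAct_ofIdx (P : RootPairing ι ℝ M N) (i : ι) (x : N) :
    coweightAct P (RootPairing.weylGroup.ofIdx P i) x = P.coreflection i x := by
  simp [coweightAct, RootPairing.weylGroup.ofIdx]

theorem pairing_coweightAct (P : RootPairing ι ℝ M N) (w : P.weylGroup) (m : M) (x : N) :
    P.toLinearMap m (coweightAct P w x) = P.toLinearMap (w⁻¹ • m) x :=
  (LinearMap.congr_fun
    (RootPairing.Hom.weight_coweight_transpose_apply P P x ((w : P.Aut)⁻¹).toHom) m).symm

theorem root'_coweightAct (P : RootPairing ι ℝ M N) (w : P.weylGroup) (i : ι) (x : N) :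
    P.root' i (coweightAct P w x) = P.root' (P.weylGroupToPerm w⁻¹ i) x := by
  have h := pairing_coweightAct P w (P.root i) x
  rw [P.weylGroup_apply_root] at h
  exact h

theorem coweightAct_mem (P : RootPairing ι ℝ M N) (w : P.weylGroup) {x : N}
    (hx : x ∈ coweightLattice P) : coweightAct P w x ∈ coweightLattice P := fun i => by
  rw [root'_coweightAct]
  exact hx _

/-- The Weyl group acts on the coweight lattice. -/
instance latticeAction (P : RootPairing ι ℝ M N) :
    DistribMulAction P.weylGroup (coweightLattice P) where
  smul w x := ⟨coweightAct P w x, coweightAct_mem P w x.2⟩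
  one_smul x := Subtype.ext (coweightAct_one P x)
  mul_smul v w x := Subtype.ext (coweightAct_mul P v w x)
  smul_zero w := Subtype.ext (map_zero (coweightAct P w))
  smul_add w x y := Subtype.ext (map_add (coweightAct P w) (x : N) (y : N))

/-- The subgroup `qZ` of the coweight lattice `Z`. -/
def multiples (P : RootPairing ι ℝ M N) (q : ℕ) : AddSubgroup (coweightLattice P) :=
  (nsmulAddMonoidHom (α := coweightLattice P) q).range

/-- The quotient `Z / qZ`. -/
abbrev LatticeMod (P : RootPairing ι ℝ M N) (q : ℕ) : Type _ :=
  coweightLattice P ⧸ multiples P q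

/-- The endomorphism of `Z / qZ` induced by a Weyl group element. -/
def modAct (P : RootPairing ι ℝ M N) (q : ℕ) (w : P.weylGroup) :
    LatticeMod P q →+ LatticeMod P q :=
  QuotientAddGroup.map (multiples P q) (multiples P q)
    (DistribSMul.toAddMonoidHom (coweightLattice P) w) (by
      rintro _ ⟨x, rfl⟩
      exact ⟨w • x, ((DistribSMul.toAddMonoidHom (coweightLattice P) w).map_nsmul q x).symm⟩)

/-- The complement `M(Φ; q)`: classes `π_q(x)` in `Z / qZ` of those `x` for which no root takes a
value divisible by `q`. (Since `Φ = Φ⁺ ∪ -Φ⁺`, it is the same to use positive roots only.) -/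
def complement (P : RootPairing ι ℝ M N) (q : ℕ) : Set (LatticeMod P q) :=
  {y | ∃ x : coweightLattice P, (x : LatticeMod P q) = y ∧
    ∀ i, ¬ ∃ k : ℤ, P.root' i (x : N) = (q : ℝ) * k}

theorem modAct_mem (P : RootPairing ι ℝ M N) (q : ℕ) (w : P.weylGroup) {y : LatticeMod P q}
    (hy : y ∈ complement P q) : modAct P q w y ∈ complement P q := by
  obtain ⟨x, rfl, hx⟩ := hy
  refine ⟨w • x, rfl, fun i => ?_⟩
  change ¬ ∃ k : ℤ, P.root' i (coweightAct P w (x : N)) = (q : ℝ) * k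
  rw [root'_coweightAct]
  exact hx _

/-- The Weyl group acts on `M(Φ; q)` by `w · π_q(x) = π_q(w x)`. -/
instance complementAction (P : RootPairing ι ℝ M N) (q : ℕ) :
    MulAction P.weylGroup (complement P q) where
  smul w y := ⟨modAct P q w y, modAct_mem P q w y.2⟩
  one_smul y := by
    obtain ⟨y, hy⟩ := y
    refine Subtype.ext ?_
    induction y using QuotientAddGroup.induction_on with
    | H x => exact congrArg (QuotientAddGroup.mk (s := multiples P q)) (one_smul P.weylGroup x)
  mul_smul v w y := by
    obtain ⟨y, hy⟩ := y
    refine Subtype.ext ?_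
    induction y using QuotientAddGroup.induction_on with
    | H x => exact congrArg (QuotientAddGroup.mk (s := multiples P q)) (mul_smul v w x)

/-- The equivariant characteristic quasi-polynomial `χ_{Φ,q}`: the permutation character of the
Weyl group on `M(Φ; q)`. -/
def equivChar (P : RootPairing ι ℝ M N) (q : ℕ) (w : P.weylGroup) : ℕ :=
  permCharacter P.weylGroup (complement P q) w

/-! ### The elements `ω_j` and root systems of type `D_ℓ` -/

/-- The simple reflections in the simple roots indexed by `K`. -/
def simpleReflections (P : RootPairing ι ℝ M N) (K : Set ι) : Set P.weylGroup :=
  RootPairing.weylGroup.ofIdx P '' K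

/-- For a base `b` and a simple root with index `j`: the element `ω_j = w_j w_0`, where `w_0` is the
longest element of the Weyl group and `w_j` is the longest element of the parabolic subgroup
generated by the simple reflections other than `s_j`. -/
def omega [Finite ι] {P : RootPairing ι ℝ M N} [P.IsRootSystem] (b : P.Base) (j : ι) :
    P.weylGroup :=
  longestElement (simpleReflections P ((b.support : Set ι) \ {j})) *
    longestElement (simpleReflections P (b.support : Set ι))

/-- `α` lists the simple roots of the base `b` as `α_1, …, α_ℓ` (here `α 0, …, α (ℓ - 1)`) such that
the Cartan matrix is that of type `D_ℓ`: `α_1, …, α_{ℓ-2}` is a chain whose end `α_{ℓ-2}` is joined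
to both `α_{ℓ-1}` and `α_ℓ`. -/
def IsLabellingD {P : RootPairing ι ℝ M N} [P.IsCrystallographic] (b : P.Base) (ℓ : ℕ)
    (α : Fin ℓ ≃ b.support) : Prop :=
  ∀ i j, b.cartanMatrix (α i) (α j) = CartanMatrix.D ℓ i j

end WeylChar

end

/-!
Let `e` be the frame in terms of which the simple roots are `e i - e (i + 1)` and
`e (ℓ - 2) + e (ℓ - 1)`; the roots are then the vectors `± e i ± e j`. The doubled coordinates
`2 (e i, x)` of a coweight `x` are integers of a common parity, and reduced modulo `2 q` they
describe `x` modulo `q Z` up to adding `q` to all coordinates. The class of `x` lies in the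
complement if and only if the residues are pairwise distinct up to sign. A Weyl group element
acts by a signed permutation, so `2 χ(w)` is the number of such tuples of residues that are fixed
by it up to a shift by `q`.

The longest element acts as `-1`, hence `ω_1` changes the signs of the first and the last
coordinate and `ω_ℓ` reverses the coordinates and negates them. In each case the fixed tuples
correspond to families that pick elements from distinct orbits of a group of order `2` or `4`
acting on the residues of a given parity. The orbits that are not free come from the residues `r`
with `2 r = 0` or `2 r = q`, which is where `q` modulo `4` enters.
-/

noncomputable section

namespace WeylChar

section SeparatedTuples

variable {A κ : Type*} (s : Setoid A) (S T : Set A) (n : ℕ)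

/-- Families of pairwise inequivalent elements of `S`. -/
def separatedTuples (κ : Type*) : Set (κ → A) :=
  {y | (∀ i, y i ∈ S) ∧ Pairwise fun i j => ¬ s (y i) (y j)}

/-- The number of families of `n` pairwise inequivalent elements of `S`. -/
def sepCount : ℕ := Nat.card (separatedTuples s S (Fin n))

theorem card_separatedTuples (κ : Type*) [Fintype κ] :
    Nat.card (separatedTuples s S κ) = sepCount s S (Fintype.card κ) := by
  let e := Fintype.equivFin κ
  refine Nat.card_congr ((e.arrowCongr (Equiv.refl A)).subtypeEquiv fun y => and_congr ?_ ?_)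
  · exact e.forall_congr_left
  · exact ⟨fun h => h.comp_of_injective e.symm.injective,
      fun h i j hij => by simpa using h (e.injective.ne hij)⟩

/-- A separated tuple is its first entry followed by a tuple avoiding the class of that entry. -/
def separatedTuplesSuccEquiv :
    separatedTuples s S (Fin (n + 1)) ≃ Σ a : S, separatedTuples s {b ∈ S | ¬ s a b} (Fin n) where
  toFun y := ⟨⟨y.1 0, y.2.1 0⟩, fun i => y.1 i.succ,
    fun i => ⟨y.2.1 i.succ, y.2.2 (Fin.succ_ne_zero i).symm⟩,
    fun _ _ hij => y.2.2 ((Fin.succ_injective n).ne hij)⟩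
  invFun z := ⟨Fin.cons z.1.1 z.2.1, Fin.cases z.1.2 fun i => (z.2.2.1 i).1, by
    intro i j
    induction i using Fin.cases <;> induction j using Fin.cases
    · simp
    · exact fun _ => (z.2.2.1 _).2
    · exact fun _ h => (z.2.2.1 _).2 (s.symm h)
    · exact fun hij => z.2.2.2 (ne_of_apply_ne Fin.succ hij)⟩
  left_inv y := Subtype.ext (Fin.cons_self_tail y.1)
  right_inv _ := rfl

theorem sepCount_zero : sepCount s S 0 = 1 := by
  have : Unique (separatedTuples s S (Fin 0)) :=
    { default := ⟨finZeroElim, fun i => i.elim0, fun i => i.elim0⟩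
      uniq := fun _ => Subtype.ext (Subsingleton.elim _ _) }
  exact Nat.card_unique

theorem sepCount_succ [Finite A] [Fintype S] :
    sepCount s S (n + 1) = ∑ a : S, sepCount s {b ∈ S | ¬ s a b} n := by
  rw [sepCount, Nat.card_congr (separatedTuplesSuccEquiv s S n), Nat.card_sigma]
  rfl

variable {S T}

theorem ncard_not_rel_add_ncard_rel [Finite A] (a : A) :
    {b ∈ S | ¬ s a b}.ncard + {b ∈ S | s a b}.ncard = S.ncard := by
  rw [add_comm]
  exact Set.ncard_inter_add_ncard_sdiff_eq_ncard S {b | s a b}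

theorem sepCount_of_ncard_class [Finite A] {d : ℕ} {R : Type*} [CommRing R]
    (h : ∀ a ∈ S, {b ∈ S | s a b}.ncard = d) (n : ℕ) :
    (sepCount s S n : R) = ∏ k ∈ Finset.range n, ((S.ncard : R) - d * k) := by
  induction n generalizing S with
  | zero => simp [sepCount_zero]
  | succ n ih =>
    have hclass (a : S) : ∀ c ∈ {b ∈ S | ¬ s a b}, {b ∈ {b ∈ S | ¬ s a b} | s c b}.ncard = d := by
      rintro c ⟨hc, hac⟩
      rw [← h c hc]
      congr 1 with b
      exact ⟨fun hb => ⟨hb.1.1, hb.2⟩,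
        fun hb => ⟨⟨hb.1, fun hab => hac (s.trans hab (s.symm hb.2))⟩, hb.2⟩⟩
    have hterm (a : S) : (sepCount s {b ∈ S | ¬ s a b} n : R) =
        ∏ k ∈ Finset.range n, ((S.ncard : R) - d * (k + 1 : ℕ)) := by
      rw [ih (hclass a), ← ncard_not_rel_add_ncard_rel s (S := S) (a : A), h a a.2]
      exact Finset.prod_congr rfl fun k _ => by push_cast; ring
    have := Fintype.ofFinite S
    rw [sepCount_succ, Nat.cast_sum, Finset.sum_congr rfl fun a _ => hterm a, Finset.sum_const,
      Finset.card_univ, ← Nat.card_eq_fintype_card, Nat.card_coe_set_eq, Finset.prod_range_succ']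
    simp [mul_comm]

/-- The entries lying in `T` of a tuple separated in `S ∪ T`, and those lying in `S`, can be chosen
independently. -/
def separatedTuplesUnionEquiv (hST : ∀ a ∈ S, ∀ b ∈ T, ¬ s a b) (u : κ → Prop)
    [DecidablePred u] :
    {y ∈ separatedTuples s (S ∪ T) κ | ∀ i, y i ∈ T ↔ u i} ≃
      separatedTuples s T {i // u i} × separatedTuples s S {i // ¬ u i} where
  toFun y := (⟨fun i => y.1 i, fun i => (y.2.2 i).2 i.2,
      fun i j hij => y.2.1.2 (Subtype.coe_injective.ne hij)⟩,
    ⟨fun i => y.1 i, fun i => (y.2.1.1 i).resolve_right fun h => i.2 ((y.2.2 i).1 h),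
      fun i j hij => y.2.1.2 (Subtype.coe_injective.ne hij)⟩)
  invFun z := ⟨fun i => if h : u i then z.1.1 ⟨i, h⟩ else z.2.1 ⟨i, h⟩, by
    refine ⟨⟨fun i => ?_, fun i j hij => ?_⟩, fun i => ?_⟩
    · by_cases h : u i
      · simpa [h] using Or.inr (z.1.2.1 ⟨i, h⟩)
      · simpa [h] using Or.inl (z.2.2.1 ⟨i, h⟩)
    · by_cases hi : u i <;> by_cases hj : u j <;> simp only [hi, hj, dite_true, dite_false]
      · exact z.1.2.2 (by simpa using hij)
      · exact fun h => hST _ (z.2.2.1 ⟨j, hj⟩) _ (z.1.2.1 ⟨i, hi⟩) (s.symm h)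
      · exact hST _ (z.2.2.1 ⟨i, hi⟩) _ (z.1.2.1 ⟨j, hj⟩)
      · exact z.2.2.2 (by simpa using hij)
    · by_cases h : u i
      · simpa [h] using z.1.2.1 ⟨i, h⟩
      · simpa [h] using fun hT => hST _ (z.2.2.1 ⟨i, h⟩) _ hT (s.refl _)⟩
  left_inv y := Subtype.ext (funext fun i => by by_cases h : u i <;> simp [h])
  right_inv z := Prod.ext (Subtype.ext (funext fun i => by simp [i.2]))
    (Subtype.ext (funext fun i => by simp [i.2]))

theorem card_separatedTuples_union_fiber [Fintype κ] (hST : ∀ a ∈ S, ∀ b ∈ T, ¬ s a b)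
    (u : Finset κ) :
    Nat.card {y ∈ separatedTuples s (S ∪ T) κ | ∀ i, y i ∈ T ↔ i ∈ u} =
      sepCount s T u.card * sepCount s S (Fintype.card κ - u.card) := by
  classical
  rw [Nat.card_congr (separatedTuplesUnionEquiv s hST (· ∈ u)), Nat.card_prod,
    card_separatedTuples, card_separatedTuples, Fintype.card_subtype_compl, Fintype.card_coe]

theorem sepCount_union [Finite A] (hST : ∀ a ∈ S, ∀ b ∈ T, ¬ s a b) (n : ℕ) :
    sepCount s (S ∪ T) n =
      ∑ k ∈ Finset.range (n + 1), n.choose k * (sepCount s T k * sepCount s S (n - k)) := by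
  classical
  let support (y : separatedTuples s (S ∪ T) (Fin n)) : Finset (Fin n) := {i | y.1 i ∈ T}
  have hfiber (u : Finset (Fin n)) : Nat.card {y // support y = u} =
      sepCount s T u.card * sepCount s S (n - u.card) := by
    have hu := card_separatedTuples_union_fiber s hST u
    rw [Fintype.card_fin] at hu
    rw [← hu]
    refine Nat.card_congr ((Equiv.subtypeEquivRight fun y => ?_).trans
      (Equiv.subtypeSubtypeEquivSubtypeInter
        (· ∈ separatedTuples s (S ∪ T) (Fin n)) fun y => ∀ i, y i ∈ T ↔ i ∈ u))
    simp [support, Finset.ext_iff]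
  rw [sepCount, ← Nat.card_congr (Equiv.sigmaFiberEquiv support), Nat.card_sigma,
    Finset.sum_congr rfl fun u _ => hfiber u, ← Finset.powerset_univ,
    Finset.sum_powerset_apply_card fun k => sepCount s T k * sepCount s S (n - k)]
  simp

theorem sepCount_union_of_class [Finite A] (hST : ∀ a ∈ S, ∀ b ∈ T, ¬ s a b)
    (hT : ∀ a ∈ T, ∀ b ∈ T, s a b) (n : ℕ) :
    sepCount s (S ∪ T) (n + 1) =
      sepCount s S (n + 1) + (n + 1) * T.ncard * sepCount s S n := by
  have hclass (k : ℕ) : (sepCount s T k : ℤ) = ∏ j ∈ Finset.range k, (T.ncard - T.ncard * j : ℤ) :=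
    sepCount_of_ncard_class s (fun a ha => by rw [Set.sep_eq_self_iff_mem_true.2 (hT a ha)]) k
  have hone : sepCount s T 1 = T.ncard := by simpa using hclass 1
  have htwo (k : ℕ) : sepCount s T (k + 2) = 0 := by
    simpa [Finset.prod_range_succ'] using hclass (k + 2)
  rw [sepCount_union s hST, Finset.sum_range_succ', Finset.sum_range_succ']
  simp only [htwo, hone, sepCount_zero, zero_mul, mul_zero, Finset.sum_const_zero, zero_add,
    Nat.choose_one_right, Nat.choose_zero_right, one_mul, Nat.add_sub_cancel, Nat.sub_zero]
  ring

theorem sepCount_of_pairwise [Finite A] (hT : T.Pairwise fun a b => ¬ s a b) (n : ℕ) :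
    sepCount s T n = T.ncard.descFactorial n := by
  have hclass (a : A) (ha : a ∈ T) : {b ∈ T | s a b}.ncard = 1 := by
    refine Set.ncard_eq_one.2 ⟨a, Set.eq_singleton_iff_unique_mem.2 ⟨⟨ha, s.refl a⟩, ?_⟩⟩
    exact fun b hb => by_contra fun hba => hT ha hb.1 (Ne.symm hba) hb.2
  have h := sepCount_of_ncard_class s (R := ℤ) hclass n
  rw [Nat.cast_one] at h
  simp only [one_mul] at h
  rw [← Nat.cast_inj (R := ℤ), h, ← descPochhammer_eval_eq_prod_range,
    descPochhammer_eval_eq_descFactorial]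

theorem sepCount_union_of_pairwise [Finite A] (hST : ∀ a ∈ S, ∀ b ∈ T, ¬ s a b)
    (hT : T.Pairwise fun a b => ¬ s a b) (hcard : T.ncard ≤ 2) (n : ℕ) :
    sepCount s (S ∪ T) (n + 2) = sepCount s S (n + 2) + (n + 2) * T.ncard * sepCount s S (n + 1) +
      (n + 2).choose 2 * T.ncard.descFactorial 2 * sepCount s S n := by
  have hthree (k : ℕ) : sepCount s T (k + 3) = 0 := by
    rw [sepCount_of_pairwise s hT, Nat.descFactorial_of_lt (by omega)]
  rw [sepCount_union s hST, Finset.sum_range_succ', Finset.sum_range_succ', Finset.sum_range_succ']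
  simp only [hthree]
  simp only [sepCount_of_pairwise s hT, zero_mul, mul_zero, Finset.sum_const_zero, zero_add,
    Nat.descFactorial_one, Nat.descFactorial_zero, Nat.choose_one_right, Nat.choose_zero_right,
    one_mul, Nat.add_sub_cancel, Nat.sub_zero, Nat.reduceAdd, Nat.add_succ_sub_one]
  ring

end SeparatedTuples

section Residues

variable (q : ℕ)

/-- The relation of being equal up to sign. -/
def negSetoid (A : Type*) [InvolutiveNeg A] : Setoid A where
  r a b := a = b ∨ a = -b
  iseqv :=
    { refl := fun _ => Or.inl rfl
      symm := by rintro a b (rfl | rfl) <;> simp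
      trans := by rintro a b c (rfl | rfl) (rfl | rfl) <;> simp }

theorem negSetoid_iff {A : Type*} [InvolutiveNeg A] {a b : A} :
    negSetoid A a b ↔ a = b ∨ a = -b := Iff.rfl

/-- Reduction of residues modulo `2q` to residues modulo `q`. -/
def reduction : ZMod (2 * q) →+* ZMod q := ZMod.castHom (dvd_mul_left q 2) (ZMod q)

/-- The parity of a residue modulo `2q`. -/
def parity : ZMod (2 * q) →+* ZMod 2 := ZMod.castHom (dvd_mul_right 2 q) (ZMod 2)

/-- The relation on residues modulo `2q` of being equal modulo `q` up to sign; its classes are the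
orbits of the Klein four-group generated by `a ↦ -a` and `a ↦ a + q`. -/
def kleinSetoid : Setoid (ZMod (2 * q)) := (negSetoid (ZMod q)).comap (reduction q)

theorem natCast_add_self : (q : ZMod (2 * q)) + q = 0 := by
  rw [← two_mul]
  exact_mod_cast ZMod.natCast_self (2 * q)

theorem natCast_ne_zero [NeZero q] : (q : ZMod (2 * q)) ≠ 0 := by
  rw [Ne, ZMod.natCast_eq_zero_iff]
  have := NeZero.pos q
  exact fun h => absurd (Nat.le_of_dvd this h) (by omega)

variable {q}

theorem two_mul_eq_zero_iff_reduction {a : ZMod (2 * q)} : 2 * a = 0 ↔ reduction q a = 0 := by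
  obtain ⟨k, rfl⟩ := ZMod.intCast_surjective a
  rw [map_intCast, ZMod.intCast_zmod_eq_zero_iff_dvd, ← mul_dvd_mul_iff_left (two_ne_zero (α := ℤ))]
  exact_mod_cast ZMod.intCast_zmod_eq_zero_iff_dvd (2 * k) (2 * q)

theorem two_mul_eq_zero_iff {a : ZMod (2 * q)} : 2 * a = 0 ↔ a = 0 ∨ a = q := by
  refine ⟨fun h => ?_, ?_⟩
  · obtain ⟨k, rfl⟩ := ZMod.intCast_surjective a
    rw [two_mul_eq_zero_iff_reduction, map_intCast, ZMod.intCast_zmod_eq_zero_iff_dvd] at h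
    obtain ⟨m, rfl⟩ := h
    obtain ⟨r, rfl | rfl⟩ := m.even_or_odd'
    · exact Or.inl (by push_cast; linear_combination (r : ZMod (2 * q)) * natCast_add_self q)
    · exact Or.inr (by push_cast; linear_combination (r : ZMod (2 * q)) * natCast_add_self q)
  · rintro (rfl | rfl)
    · exact mul_zero 2
    · exact (two_mul _).trans (natCast_add_self q)

theorem reduction_eq_iff {a b : ZMod (2 * q)} :
    reduction q a = reduction q b ↔ a = b ∨ a = b + q := by
  rw [← sub_eq_zero, ← map_sub, ← two_mul_eq_zero_iff_reduction, two_mul_eq_zero_iff, sub_eq_zero,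
    sub_eq_iff_eq_add']

theorem kleinSetoid_iff {a b : ZMod (2 * q)} :
    kleinSetoid q a b ↔ (a = b ∨ a = b + q) ∨ (a = -b ∨ a = -b + q) := by
  rw [← reduction_eq_iff, ← reduction_eq_iff, map_neg]
  rfl

variable (q)

/-- The residues modulo `2q` of parity `p`. -/
def level (p : ZMod 2) : Set (ZMod (2 * q)) := {a | parity q a = p}

/-- The residues of parity `p` fixed by `a ↦ -a`. -/
def torsion (p : ZMod 2) : Set (ZMod (2 * q)) := {a ∈ level q p | 2 * a = 0}

/-- The residues of parity `p` moved by `a ↦ -a`. -/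
def moving (p : ZMod 2) : Set (ZMod (2 * q)) := {a ∈ level q p | 2 * a ≠ 0}

/-- The residues of parity `p` fixed by `a ↦ q - a`. -/
def halves (p : ZMod 2) : Set (ZMod (2 * q)) := {a ∈ level q p | 2 * a = q}

/-- The residues of parity `p` moved by both `a ↦ -a` and `a ↦ q - a`. -/
def kleinMoving (p : ZMod 2) : Set (ZMod (2 * q)) := {a ∈ level q p | 2 * a ≠ 0 ∧ 2 * a ≠ q}

theorem parity_natCast (n : ℕ) : parity q n = n := map_natCast _ _

theorem parity_neg (a : ZMod (2 * q)) : parity q (-a) = parity q a := by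
  rw [map_neg, ZMod.neg_eq_self_mod_two]

variable {q} in
theorem parity_add_self_of_even (hq : Even q) (a : ZMod (2 * q)) :
    parity q (a + q) = parity q a := by
  rw [map_add, parity_natCast, ZMod.natCast_eq_zero_iff_even.2 hq, add_zero]

theorem moving_union_torsion (p : ZMod 2) : moving q p ∪ torsion q p = level q p := by
  ext a
  simp only [moving, torsion, Set.mem_union, Set.mem_ofPred_eq]
  tauto

theorem ncard_negSetoid_class {p : ZMod 2} {a : ZMod (2 * q)} (ha : a ∈ moving q p) :
    {b ∈ moving q p | negSetoid _ a b}.ncard = 2 := by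
  rw [Set.ncard_eq_two]
  refine ⟨a, -a, fun h => ha.2 (by linear_combination h), ?_⟩
  ext b
  simp only [negSetoid_iff, Set.mem_ofPred_eq, Set.mem_insert_iff, Set.mem_singleton_iff]
  constructor
  · rintro ⟨-, rfl | rfl⟩ <;> simp
  · rintro (rfl | rfl)
    · exact ⟨ha, Or.inl rfl⟩
    · exact ⟨⟨(parity_neg q a).trans ha.1, by simpa using ha.2⟩, Or.inr (neg_neg a).symm⟩

variable {q} in
theorem neg_mem_kleinMoving {p : ZMod 2} {a : ZMod (2 * q)} (ha : a ∈ kleinMoving q p) :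
    -a ∈ kleinMoving q p := by
  obtain ⟨hp, h0, h1⟩ := ha
  exact ⟨(parity_neg q a).trans hp, fun h => h0 (by linear_combination -h),
    fun h => h1 (by linear_combination -h - natCast_add_self q)⟩

variable {q} in
theorem add_mem_kleinMoving (hq : Even q) {p : ZMod 2} {a : ZMod (2 * q)}
    (ha : a ∈ kleinMoving q p) : a + q ∈ kleinMoving q p := by
  obtain ⟨hp, h0, h1⟩ := ha
  have htwo : 2 * (a + q) = 2 * a := by linear_combination natCast_add_self q
  exact ⟨(parity_add_self_of_even hq a).trans hp, htwo ▸ h0, htwo ▸ h1⟩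

theorem not_negSetoid_of_mem_moving_of_mem_torsion {p : ZMod 2} :
    ∀ a ∈ moving q p, ∀ b ∈ torsion q p, ¬ negSetoid _ a b := by
  rintro a ha b hb (rfl | rfl)
  · exact ha.2 hb.2
  · exact ha.2 (by rw [mul_neg, hb.2, neg_zero])

theorem pairwise_torsion (p : ZMod 2) : (torsion q p).Pairwise fun a b => ¬ negSetoid _ a b := by
  rintro a - b hb hab (rfl | rfl)
  · exact hab rfl
  · exact hab (by linear_combination -hb.2)

variable [NeZero q]

theorem ncard_level (p : ZMod 2) : (level q p).ncard = q := by
  have hfiber (p : ZMod 2) : (level q p).ncard = (level q 0).ncard := by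
    obtain ⟨c, hc⟩ := ZMod.castHom_surjective (dvd_mul_right 2 q) p
    rw [← Set.ncard_image_of_injective (level q 0) (add_right_injective c)]
    congr 1 with a
    simp only [level, Set.mem_ofPred_eq, Set.mem_image]
    refine ⟨fun ha => ⟨a - c, ?_, add_sub_cancel c a⟩, ?_⟩
    · rw [map_sub, ha, sub_eq_zero]
      exact hc.symm
    · rintro ⟨b, hb, rfl⟩
      rw [map_add, hb, add_zero]
      exact hc
  have htotal := Nat.card_congr (Equiv.sigmaFiberEquiv (parity q))
  rw [Nat.card_sigma, Nat.card_zmod] at htotal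
  have hsum : ∑ p : ZMod 2, (level q p).ncard = 2 * q :=
    (Finset.sum_congr rfl fun p _ => (Nat.card_coe_set_eq _).symm).trans htotal
  simp only [hfiber, Finset.sum_const, Finset.card_univ, ZMod.card, smul_eq_mul] at hsum
  rw [hfiber p]
  omega

theorem ncard_torsion (p : ZMod 2) :
    (torsion q p).ncard = (if 0 = p then 1 else 0) + if (q : ZMod 2) = p then 1 else 0 := by
  have htorsion : torsion q p =
      {a : ZMod (2 * q) | a = 0 ∧ 0 = p} ∪ {a | a = q ∧ (q : ZMod 2) = p} := by
    ext a
    simp only [torsion, level, two_mul_eq_zero_iff, Set.mem_ofPred_eq, Set.mem_union]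
    constructor
    · rintro ⟨rfl, rfl | rfl⟩ <;> simp
    · rintro (⟨rfl, rfl⟩ | ⟨rfl, rfl⟩) <;> simp
  have hdisjoint : Disjoint {a : ZMod (2 * q) | a = 0 ∧ 0 = p} {a | a = q ∧ (q : ZMod 2) = p} :=
    Set.disjoint_left.2 fun a ha ha' => natCast_ne_zero q (ha'.1.symm.trans ha.1)
  rw [htorsion, Set.ncard_union_eq hdisjoint]
  congr 1 <;> split_ifs with h <;> simp [h]

theorem ncard_torsion_le_two (p : ZMod 2) : (torsion q p).ncard ≤ 2 := by
  rw [ncard_torsion]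
  split_ifs <;> simp

theorem ncard_halves_two_mul (h : ℕ) [NeZero (2 * h)] (p : ZMod 2) :
    (halves (2 * h) p).ncard = if (h : ZMod 2) = p then 2 else 0 := by
  have hhalf : ∀ a : ZMod (2 * (2 * h)), 2 * a = (2 * h : ℕ) ↔ a = h ∨ a = h + (2 * h : ℕ) := by
    intro a
    rw [← sub_eq_zero, show 2 * a - (2 * h : ℕ) = 2 * (a - h) by push_cast; ring,
      two_mul_eq_zero_iff, sub_eq_zero, sub_eq_iff_eq_add']
  have hparity := parity_add_self_of_even (q := 2 * h) (even_two_mul h) h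
  rw [map_natCast] at hparity
  split_ifs with hp
  · subst hp
    rw [Set.ncard_eq_two]
    refine ⟨h, h + (2 * h : ℕ), fun heq => natCast_ne_zero (2 * h) (by simpa using heq), ?_⟩
    ext a
    simp only [halves, level, hhalf, Set.mem_ofPred_eq, Set.mem_insert_iff, Set.mem_singleton_iff,
      and_iff_right_iff_imp]
    rintro (rfl | rfl)
    exacts [map_natCast _ _, hparity]
  · rw [Set.ncard_eq_zero, Set.eq_empty_iff_forall_notMem]
    rintro a ⟨rfl, ha⟩
    rcases (hhalf a).1 ha with rfl | rfl
    exacts [hp (map_natCast _ _).symm, hp hparity.symm]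

theorem ncard_moving (p : ZMod 2) : ((moving q p).ncard : ℚ) = q - (torsion q p).ncard := by
  rw [eq_sub_iff_add_eq, ← Nat.cast_add, add_comm]
  exact_mod_cast (Set.ncard_inter_add_ncard_sdiff_eq_ncard (level q p) {a | 2 * a = 0}).trans
    (ncard_level q p)

theorem ncard_kleinMoving (p : ZMod 2) :
    ((kleinMoving q p).ncard : ℚ) = q - (torsion q p).ncard - (halves q p).ncard := by
  have hhalves : halves q p = moving q p ∩ {a | 2 * a = q} := by
    ext a
    refine ⟨fun ha => ⟨⟨ha.1, ?_⟩, ha.2⟩, fun ha => ⟨ha.1.1, ha.2⟩⟩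
    rw [ha.2]
    exact natCast_ne_zero q
  have hsplit := Set.ncard_inter_add_ncard_sdiff_eq_ncard (moving q p) {a | 2 * a = q}
  have hkleinMoving : moving q p \ {a | 2 * a = q} = kleinMoving q p := Set.ext fun _ => and_assoc
  rw [← ncard_moving, eq_sub_iff_add_eq, ← Nat.cast_add, add_comm, ← hsplit, hkleinMoving, hhalves]

theorem ncard_kleinSetoid_class (hq : Even q) {p : ZMod 2} {a : ZMod (2 * q)}
    (ha : a ∈ kleinMoving q p) : {b ∈ kleinMoving q p | kleinSetoid q a b}.ncard = 4 := by
  have hclass : {b ∈ kleinMoving q p | kleinSetoid q a b} = {a, a + q, -a, -a + q} := by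
    ext b
    rw [Set.mem_ofPred_eq, Setoid.comm' (kleinSetoid q), kleinSetoid_iff]
    simp only [Set.mem_insert_iff, Set.mem_singleton_iff, ← or_assoc, and_iff_right_iff_imp]
    rintro (((rfl | rfl) | rfl) | rfl)
    exacts [ha, add_mem_kleinMoving hq ha, neg_mem_kleinMoving ha,
      add_mem_kleinMoving hq (neg_mem_kleinMoving ha)]
  have hqq := natCast_add_self q
  have hq0 := natCast_ne_zero q
  obtain ⟨-, h0, h1⟩ := ha
  have hneg : a ≠ -a := fun h => h0 (by linear_combination h)
  have hshift : a ≠ -a + q := fun h => h1 (by linear_combination h)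
  have hshift' : a + q ≠ -a := fun h => h1 (by linear_combination h - hqq)
  rw [hclass, Set.ncard_insert_of_notMem (by simp [hneg, hshift, hq0]),
    Set.ncard_insert_of_notMem (by simp [hneg, hshift']), Set.ncard_pair (by simp [hq0])]

theorem sepCount_moving (p : ZMod 2) (n : ℕ) : (sepCount (negSetoid _) (moving q p) n : ℚ) =
    ∏ k ∈ Finset.range n, ((q : ℚ) - (torsion q p).ncard - 2 * k) := by
  rw [sepCount_of_ncard_class (negSetoid _) (fun a ha => ncard_negSetoid_class q ha), ncard_moving]
  rfl

variable {q} in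
theorem sepCount_kleinMoving (hq : Even q) (p : ZMod 2) (n : ℕ) :
    (sepCount (kleinSetoid q) (kleinMoving q p) n : ℚ) =
      ∏ k ∈ Finset.range n, ((q : ℚ) - (torsion q p).ncard - (halves q p).ncard - 4 * k) := by
  rw [sepCount_of_ncard_class (kleinSetoid q) (fun a ha => ncard_kleinSetoid_class q hq ha),
    ncard_kleinMoving]
  rfl

theorem sepCount_level (p : ZMod 2) (n : ℕ) : (sepCount (negSetoid _) (level q p) (n + 2) : ℚ) =
    (∏ k ∈ Finset.range n, ((q : ℚ) - (torsion q p).ncard - 2 * k)) *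
      ((q - (torsion q p).ncard - 2 * n) * (q - (torsion q p).ncard - 2 * (n + 1)) +
        (n + 2) * (torsion q p).ncard * (q - (torsion q p).ncard - 2 * n) +
        (n + 2) * (n + 1) / 2 * ((torsion q p).ncard * ((torsion q p).ncard - 1))) := by
  have hcount := sepCount_union_of_pairwise (negSetoid _)
    (not_negSetoid_of_mem_moving_of_mem_torsion q) (pairwise_torsion q p)
    (ncard_torsion_le_two q p) n
  rw [moving_union_torsion] at hcount
  rw [hcount]
  push_cast
  rw [sepCount_moving, sepCount_moving, sepCount_moving, Finset.prod_range_succ,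
    Finset.prod_range_succ, Nat.cast_choose_two, Nat.cast_descFactorial_two]
  push_cast
  ring

theorem sepCount_level_sdiff_halves (hq : Even q) (p : ZMod 2) (n : ℕ) :
    (sepCount (kleinSetoid q) (level q p \ halves q p) (n + 1) : ℚ) =
    (∏ k ∈ Finset.range n, ((q : ℚ) - (torsion q p).ncard - (halves q p).ncard - 4 * k)) *
      (q - (torsion q p).ncard - (halves q p).ncard - 4 * n + (n + 1) * (torsion q p).ncard) := by
  have hunion : level q p \ halves q p = kleinMoving q p ∪ torsion q p := by
    ext a
    simp only [level, halves, kleinMoving, torsion, Set.mem_sdiff, Set.mem_union, Set.mem_ofPred_eq]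
    have := natCast_ne_zero q
    grind
  rw [hunion, sepCount_union_of_class]
  · push_cast
    rw [sepCount_kleinMoving hq, sepCount_kleinMoving hq, Finset.prod_range_succ]
    ring
  · intro a ha b hb (hab : reduction q a = reduction q b ∨ reduction q a = -reduction q b)
    rw [two_mul_eq_zero_iff_reduction.1 hb.2, neg_zero, or_self] at hab
    exact ha.2.1 (two_mul_eq_zero_iff_reduction.2 hab)
  · intro a ha b hb
    exact Or.inl ((two_mul_eq_zero_iff_reduction.1 ha.2).trans
      (two_mul_eq_zero_iff_reduction.1 hb.2).symm)

end Residues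

theorem prod_range_sub_mul_last (x c : ℚ) (n : ℕ) :
    (∏ k ∈ Finset.range n, (x - c * k)) * (x - c * n) =
      (∏ k ∈ Finset.range n, (x - c * (k + 1))) * x := by
  rw [← Finset.prod_range_succ fun k : ℕ => x - c * k, Finset.prod_range_succ']
  simp

section AdmissibleTuples

variable {κ : Type*} (q : ℕ)

/-- Tuples of residues modulo `2q` that have the same parity and are pairwise distinct up to sign:
the doubled orthogonal coordinates modulo `2q` of the points of `M(Φ; q)`, for `Φ` of type `D`. -/
def admissibleTuples (κ : Type*) : Set (κ → ZMod (2 * q)) :=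
  {y | (∀ i j, parity q (y i) = parity q (y j)) ∧ Pairwise fun i j => ¬ negSetoid _ (y i) (y j)}

/-- The admissible tuples that the signed permutation `y ↦ (i ↦ ε i • y (σ i))` fixes up to a
simultaneous shift of all entries by `q`. -/
def shiftFixedTuples (σ : Equiv.Perm κ) (ε : κ → ℤˣ) : Set (κ → ZMod (2 * q)) :=
  {y ∈ admissibleTuples q κ | (∀ i, ε i • y (σ i) = y i) ∨ ∀ i, ε i • y (σ i) = y i + q}

theorem mem_separatedTuples_level_iff {p : ZMod 2} (i₀ : κ) {y : κ → ZMod (2 * q)} :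
    y ∈ separatedTuples (negSetoid _) (level q p) κ ↔
      y ∈ admissibleTuples q κ ∧ parity q (y i₀) = p :=
  ⟨fun h => ⟨⟨fun i j => (h.1 i).trans (h.1 j).symm, h.2⟩, h.1 i₀⟩,
    fun h => ⟨fun i => (h.1.1 i i₀).trans h.2, h.1.2⟩⟩

theorem card_admissibleTuples_inter [NeZero q] [Finite κ] [Nonempty κ]
    (F : Set (κ → ZMod (2 * q))) :
    Nat.card ↑(admissibleTuples q κ ∩ F) =
      ∑ p, Nat.card ↑(separatedTuples (negSetoid _) (level q p) κ ∩ F) := by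
  obtain ⟨i₀⟩ := ‹Nonempty κ›
  rw [← Nat.card_congr (Equiv.sigmaFiberEquiv
    fun y : ↑(admissibleTuples q κ ∩ F) => parity q (y.1 i₀)), Nat.card_sigma]
  refine Finset.sum_congr rfl fun p _ => Nat.card_congr <|
    (Equiv.subtypeSubtypeEquivSubtypeInter (· ∈ admissibleTuples q κ ∩ F)
      fun y => parity q (y i₀) = p).trans (Equiv.subtypeEquivRight fun y => ?_)
  rw [Set.mem_inter_iff, Set.mem_inter_iff, mem_separatedTuples_level_iff q i₀, and_right_comm]

variable {q} in
theorem ncard_torsion_of_odd [NeZero q] (hq : ¬ 2 ∣ q) (p : ZMod 2) : (torsion q p).ncard = 1 := by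
  have hqone : (q : ZMod 2) = 1 := ZMod.natCast_eq_one_iff_odd.2 (by grind)
  rw [ncard_torsion, hqone]
  revert p
  decide

variable {q} in
theorem ncard_torsion_of_even [NeZero q] (hq : 2 ∣ q) (p : ZMod 2) :
    (torsion q p).ncard = if p = 0 then 2 else 0 := by
  have hqzero : (q : ZMod 2) = 0 := (ZMod.natCast_eq_zero_iff q 2).2 hq
  rw [ncard_torsion, hqzero]
  revert p
  decide

variable [Fintype κ] [NeZero q]

theorem card_shiftFixedTuples_one [Nonempty κ] :
    Nat.card (shiftFixedTuples q (1 : Equiv.Perm κ) 1) =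
      ∑ p, sepCount (negSetoid _) (level q p) (Fintype.card κ) := by
  have hfixed : shiftFixedTuples q (1 : Equiv.Perm κ) 1 = admissibleTuples q κ ∩ Set.univ :=
    Set.ext fun y => and_congr_right fun _ => by simp
  rw [hfixed, card_admissibleTuples_inter]
  simp only [Set.inter_univ, card_separatedTuples]

variable {q}

theorem card_shiftFixedTuples_one_of_odd (hq : ¬ 2 ∣ q) {n : ℕ} (hn : Fintype.card κ = n + 2) :
    (Nat.card (shiftFixedTuples q (1 : Equiv.Perm κ) 1) : ℚ) =
      2 * ((∏ k ∈ Finset.range (n + 1), ((q : ℚ) - (2 * k + 1))) * (q - (n + 1))) := by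
  have : Nonempty κ := Fintype.card_pos_iff.1 (by omega)
  rw [card_shiftFixedTuples_one, hn, Nat.cast_sum]
  simp only [sepCount_level, ncard_torsion_of_odd hq, Finset.sum_const, Finset.card_univ,
    ZMod.card, Finset.prod_range_succ, nsmul_eq_mul]
  push_cast
  simp only [sub_sub, add_comm (1 : ℚ)]
  ring

theorem card_shiftFixedTuples_one_of_even (hq : 2 ∣ q) {n : ℕ} (hn : Fintype.card κ = n + 2) :
    (Nat.card (shiftFixedTuples q (1 : Equiv.Perm κ) 1) : ℚ) =
      2 * ((∏ k ∈ Finset.range n, ((q : ℚ) - 2 * (k + 1))) *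
        (q ^ 2 - 2 * (n + 1) * q + (n + 2) * (n + 1) / 2)) := by
  have : Nonempty κ := Fintype.card_pos_iff.1 (by omega)
  have hsum (f : ZMod 2 → ℚ) : ∑ p, f p = f 0 + f 1 := Fin.sum_univ_two f
  have htwo : ∏ k ∈ Finset.range n, ((q : ℚ) - 2 - 2 * k) =
      ∏ k ∈ Finset.range n, ((q : ℚ) - 2 * (k + 1)) :=
    Finset.prod_congr rfl fun k _ => by ring
  rw [card_shiftFixedTuples_one, hn, Nat.cast_sum, hsum, sepCount_level, sepCount_level,
    ncard_torsion_of_even hq, ncard_torsion_of_even hq, if_pos rfl, if_neg one_ne_zero]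
  push_cast
  rw [htwo]
  simp only [sub_zero]
  linear_combination (q - 2 * ((n : ℚ) + 1)) * prod_range_sub_mul_last q 2 n

/-- The sign vector that is `-1` exactly at `a` and `b`: two sign changes, as type `D` allows only
an even number of them. -/
def negPair [DecidableEq κ] (a b : κ) : κ → ℤˣ := fun i => if i = a ∨ i = b then -1 else 1

omit [Fintype κ] in
theorem negPair_smul_of_mem [DecidableEq κ] {A : Type*} [AddCommGroup A] {a b i : κ}
    (hi : i ∈ ({a, b} : Finset κ)) (x : A) : negPair a b i • x = -x := by
  rw [Finset.mem_insert, Finset.mem_singleton] at hi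
  rw [negPair, if_pos hi, Units.neg_smul, one_smul]

omit [Fintype κ] in
theorem negPair_smul_of_notMem [DecidableEq κ] {A : Type*} [AddCommGroup A] {a b i : κ}
    (hi : i ∉ ({a, b} : Finset κ)) (x : A) : negPair a b i • x = x := by
  rw [Finset.mem_insert, Finset.mem_singleton] at hi
  rw [negPair, if_neg hi, one_smul]

omit [Fintype κ] [NeZero q] in
theorem two_mul_ne_zero_of_admissible {y : κ → ZMod (2 * q)} (hy : y ∈ admissibleTuples q κ)
    {a b c : κ} (hab : a ≠ b) (hca : c ≠ a) (hcb : c ≠ b) (ha : 2 * y a = 0) (hb : 2 * y b = 0) :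
    2 * y c ≠ 0 := by
  intro hc
  have hne {i j : κ} (hij : i ≠ j) : y i ≠ y j := fun h => hy.2 hij (Or.inl h)
  rw [two_mul_eq_zero_iff] at ha hb hc
  grind

theorem shiftFixedTuples_negPair [DecidableEq κ] {a b : κ} (hab : a ≠ b)
    (hκ : 2 < Fintype.card κ) : shiftFixedTuples q 1 (negPair a b) =
      admissibleTuples q κ ∩ {y | ∀ i, 2 * y i = 0 ↔ i ∈ ({a, b} : Finset κ)} := by
  have neg_eq_iff (x : ZMod (2 * q)) : -x = x ↔ 2 * x = 0 := by
    constructor <;> intro h <;> linear_combination -h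
  refine Set.ext fun y => and_congr_right fun hy => ⟨?_, fun h => Or.inl fun i => ?_⟩
  · rintro (hfix | hshift) i
    · have htwo {j : κ} (hj : j ∈ ({a, b} : Finset κ)) : 2 * y j = 0 := by
        rw [← neg_eq_iff, ← negPair_smul_of_mem hj]
        exact hfix j
      refine ⟨fun hi => by_contra fun hiab => ?_, htwo⟩
      rw [Finset.mem_insert, Finset.mem_singleton, not_or] at hiab
      exact two_mul_ne_zero_of_admissible hy hab hiab.1 hiab.2 (htwo (by simp)) (htwo (by simp)) hi
    · obtain ⟨c, -, hc⟩ := Finset.exists_mem_notMem_of_card_lt_card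
        ((Finset.card_pair hab).trans_lt (hκ.trans_eq Finset.card_univ.symm))
      have hq := hshift c
      rw [negPair_smul_of_notMem hc, Equiv.Perm.one_apply, left_eq_add] at hq
      exact absurd hq (natCast_ne_zero q)
  · by_cases hi : i ∈ ({a, b} : Finset κ)
    · rw [negPair_smul_of_mem hi, Equiv.Perm.one_apply, neg_eq_iff, h i]
      exact hi
    · rw [negPair_smul_of_notMem hi, Equiv.Perm.one_apply]

theorem card_shiftFixedTuples_negPair [DecidableEq κ] {a b : κ} (hab : a ≠ b) {n : ℕ}
    (hn : Fintype.card κ = n + 2) (hn0 : n ≠ 0) :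
    (Nat.card (shiftFixedTuples q 1 (negPair a b)) : ℚ) =
      ∑ p, (((torsion q p).ncard : ℚ) * ((torsion q p).ncard - 1)) *
        ∏ k ∈ Finset.range n, ((q : ℚ) - (torsion q p).ncard - 2 * k) := by
  have : Nonempty κ := ⟨a⟩
  rw [shiftFixedTuples_negPair hab (by omega), card_admissibleTuples_inter, Nat.cast_sum]
  refine Finset.sum_congr rfl fun p _ => ?_
  have hset :
      separatedTuples (negSetoid _) (level q p) κ ∩
          {y | ∀ i, 2 * y i = 0 ↔ i ∈ ({a, b} : Finset κ)} =
        {y ∈ separatedTuples (negSetoid _) (moving q p ∪ torsion q p) κ |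
          ∀ i, y i ∈ torsion q p ↔ i ∈ ({a, b} : Finset κ)} := by
    rw [moving_union_torsion]
    exact Set.ext fun y => and_congr_right fun hy => forall_congr' fun i => by
      simp only [torsion, Set.mem_ofPred_eq, hy.1 i, true_and]
  rw [hset, card_separatedTuples_union_fiber _ (not_negSetoid_of_mem_moving_of_mem_torsion q),
    Finset.card_pair hab, hn, Nat.add_sub_cancel, Nat.cast_mul, sepCount_moving,
    sepCount_of_pairwise _ (pairwise_torsion q p), Nat.cast_descFactorial_two]

theorem card_shiftFixedTuples_negPair_of_odd [DecidableEq κ] (hq : ¬ 2 ∣ q) {a b : κ}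
    (hab : a ≠ b) (hκ : 2 < Fintype.card κ) :
    Nat.card (shiftFixedTuples q 1 (negPair a b)) = 0 := by
  obtain ⟨n, hn⟩ := Nat.exists_eq_add_of_lt hκ
  rw [← Nat.cast_eq_zero (R := ℚ),
    card_shiftFixedTuples_negPair hab (n := n + 1) (by omega) (by omega)]
  simp [ncard_torsion_of_odd hq]

theorem card_shiftFixedTuples_negPair_of_even [DecidableEq κ] (hq : 2 ∣ q) {a b : κ}
    (hab : a ≠ b) {n : ℕ} (hn : Fintype.card κ = n + 2) (hn0 : n ≠ 0) :
    (Nat.card (shiftFixedTuples q 1 (negPair a b)) : ℚ) =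
      2 * ∏ k ∈ Finset.range n, ((q : ℚ) - 2 * (k + 1)) := by
  rw [card_shiftFixedTuples_negPair hab hn hn0, Finset.sum_eq_single 0]
  · rw [ncard_torsion_of_even hq, if_pos rfl]
    push_cast
    congr 1
    · norm_num
    · exact Finset.prod_congr rfl fun k _ => by ring
  · intro p _ hp
    simp [ncard_torsion_of_even hq, hp]
  · simp

end AdmissibleTuples

section ReflectedTuples

variable {m : Type*} {q : ℕ}

/-- The tuples indexed by two copies of `m` in which the second copy carries the images under
`a ↦ q - a` of the entries of the first. -/
def reflectedTuples (q : ℕ) (m : Type*) : Set (m ⊕ m → ZMod (2 * q)) :=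
  {y | ∀ i, y (Sum.inr i) = q - y (Sum.inl i)}

theorem shiftFixedTuples_sumComm :
    shiftFixedTuples q (Equiv.sumComm m m) (-1) =
      admissibleTuples q (m ⊕ m) ∩ reflectedTuples q m := by
  have hqq := natCast_add_self q
  refine Set.ext fun y => and_congr_right fun hy => ⟨?_, fun h => Or.inr ?_⟩
  · rintro (hfix | hshift) i
    · refine absurd ?_ (hy.2 (Sum.inr_ne_inl (a := i) (b := i)))
      have h := hfix (Sum.inl i)
      simp only [Pi.neg_apply, Pi.one_apply, Units.neg_smul, one_smul, Equiv.sumComm_apply,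
        Sum.swap_inl] at h
      exact Or.inr (by linear_combination -h)
    · have h := hshift (Sum.inl i)
      simp only [Pi.neg_apply, Pi.one_apply, Units.neg_smul, one_smul, Equiv.sumComm_apply,
        Sum.swap_inl] at h
      linear_combination -h - hqq
  · rintro (i | i) <;>
      simp only [Pi.neg_apply, Pi.one_apply, Units.neg_smul, one_smul, Equiv.sumComm_apply,
        Sum.swap_inl, Sum.swap_inr, h i]
    · linear_combination -hqq
    · linear_combination -hqq

theorem card_shiftFixedTuples_sumComm_of_odd [Nonempty m] (hq : ¬ 2 ∣ q) :
    Nat.card (shiftFixedTuples q (Equiv.sumComm m m) (-1)) = 0 := by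
  have hempty : shiftFixedTuples q (Equiv.sumComm m m) (-1) = ∅ := by
    rw [shiftFixedTuples_sumComm, Set.eq_empty_iff_forall_notMem]
    rintro y ⟨hy, hreflect⟩
    obtain ⟨i⟩ := ‹Nonempty m›
    have hparity := hy.1 (Sum.inr i) (Sum.inl i)
    rw [hreflect i, map_sub, map_natCast, sub_eq_iff_eq_add, CharTwo.add_self_eq_zero,
      ZMod.natCast_eq_zero_iff] at hparity
    exact hq hparity
  rw [hempty, Nat.card_eq_zero]
  exact Or.inl inferInstance

theorem kleinSetoid_of_negSetoid {a b : ZMod (2 * q)} (h : negSetoid _ a b) :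
    kleinSetoid q a b :=
  kleinSetoid_iff.2 (h.imp Or.inl Or.inl)

theorem kleinSetoid_natCast_sub (a : ZMod (2 * q)) : kleinSetoid q (q - a) a :=
  kleinSetoid_iff.2 (Or.inr (Or.inr (sub_eq_neg_add _ _)))

theorem kleinSetoid_iff_negSetoid_or {a b : ZMod (2 * q)} :
    kleinSetoid q a b ↔ negSetoid _ a b ∨ negSetoid _ a (q - b) := by
  have hqq := natCast_add_self q
  refine ⟨fun h => ?_, ?_⟩
  · rcases kleinSetoid_iff.1 h with (h | h) | h | h
    · exact Or.inl (Or.inl h)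
    · exact Or.inr (Or.inr (by linear_combination h + hqq))
    · exact Or.inl (Or.inr h)
    · exact Or.inr (Or.inl (by linear_combination h))
  · rintro (h | h)
    · exact kleinSetoid_of_negSetoid h
    · exact (kleinSetoid q).trans (kleinSetoid_of_negSetoid h) (kleinSetoid_natCast_sub b)

theorem negSetoid_natCast_sub_self_iff [NeZero q] {a : ZMod (2 * q)} :
    negSetoid _ a (q - a) ↔ 2 * a = q := by
  refine ⟨?_, fun h => Or.inl (by linear_combination h)⟩
  rintro (h | h)
  · linear_combination h
  · have hzero : (q : ZMod (2 * q)) = 0 := by linear_combination natCast_add_self q - h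
    exact absurd hzero (natCast_ne_zero q)

theorem pairwise_sumElim_iff [NeZero q] {z : m → ZMod (2 * q)} :
    (Pairwise fun i j => ¬ negSetoid _ (Sum.elim z (fun i => q - z i) i)
      (Sum.elim z (fun i => q - z i) j)) ↔
      (∀ i, 2 * z i ≠ q) ∧ Pairwise fun i j => ¬ kleinSetoid q (z i) (z j) := by
  constructor
  · refine fun h => ⟨fun i hi => ?_, fun i j hij hklein => ?_⟩
    · exact h (Sum.inl_ne_inr (a := i) (b := i)) (negSetoid_natCast_sub_self_iff.2 hi)
    · exact (kleinSetoid_iff_negSetoid_or.1 hklein).elim (h (Sum.inl_injective.ne hij))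
        (h (Sum.inl_ne_inr (a := i) (b := j)))
  · rintro ⟨hhalf, hsep⟩
    let index : m ⊕ m → m := Sum.elim id id
    have hindex (x : m ⊕ m) :
        kleinSetoid q (Sum.elim z (fun i => q - z i) x) (z (index x)) := by
      rcases x with i | i
      exacts [(kleinSetoid q).refl _, kleinSetoid_natCast_sub _]
    intro x y hxy hneg
    by_cases hij : index x = index y
    · rcases x with i | i <;> rcases y with j | j <;> obtain rfl : i = j := hij
      · exact hxy rfl
      · exact hhalf i (negSetoid_natCast_sub_self_iff.1 hneg)
      · exact hhalf i (negSetoid_natCast_sub_self_iff.1 ((negSetoid _).symm hneg))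
      · exact hxy rfl
    · exact hsep hij ((kleinSetoid q).trans ((kleinSetoid q).symm (hindex x))
        ((kleinSetoid q).trans (kleinSetoid_of_negSetoid hneg) (hindex y)))

theorem sumElim_mem_separatedTuples_iff [NeZero q] (hq : Even q) {p : ZMod 2}
    {z : m → ZMod (2 * q)} :
    Sum.elim z (fun i => q - z i) ∈ separatedTuples (negSetoid _) (level q p) (m ⊕ m) ↔
      z ∈ separatedTuples (kleinSetoid q) (level q p \ halves q p) m := by
  have hlevel {a : ZMod (2 * q)} (ha : a ∈ level q p) : ↑q - a ∈ level q p := by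
    rw [sub_eq_neg_add]
    exact (parity_add_self_of_even hq _).trans ((parity_neg q a).trans ha)
  simp only [separatedTuples, Set.mem_ofPred_eq, pairwise_sumElim_iff, Sum.forall, Sum.elim_inl,
    Sum.elim_inr, ← and_assoc, Set.mem_sdiff, halves, forall_and, not_and]
  refine and_congr_left fun _ => ⟨fun h => ⟨h.1.1, fun i _ => h.2 i⟩, fun h => ?_⟩
  exact ⟨⟨h.1, fun i => hlevel (h.1 i)⟩, fun i => h.2 i (h.1 i)⟩

theorem card_separatedTuples_inter_reflectedTuples [NeZero q] [Fintype m] (hq : Even q)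
    (p : ZMod 2) :
    Nat.card ↑(separatedTuples (negSetoid _) (level q p) (m ⊕ m) ∩ reflectedTuples q m) =
      sepCount (kleinSetoid q) (level q p \ halves q p) (Fintype.card m) := by
  have helim {y : m ⊕ m → ZMod (2 * q)} (hy : y ∈ reflectedTuples q m) :
      Sum.elim (y ∘ Sum.inl) (fun i => q - y (Sum.inl i)) = y := by
    ext (i | i)
    exacts [rfl, (hy i).symm]
  rw [← card_separatedTuples]
  exact Nat.card_congr
    { toFun y := ⟨y.1 ∘ Sum.inl, (sumElim_mem_separatedTuples_iff hq).1 (by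
        exact (helim y.2.2).symm ▸ y.2.1)⟩
      invFun z := ⟨Sum.elim z.1 fun i => q - z.1 i,
        (sumElim_mem_separatedTuples_iff hq).2 z.2, fun i => rfl⟩
      left_inv y := Subtype.ext (helim y.2.2)
      right_inv z := rfl }

variable [NeZero q] [Fintype m]

theorem card_shiftFixedTuples_sumComm_of_even [Nonempty m] (hq : Even q) :
    Nat.card (shiftFixedTuples q (Equiv.sumComm m m) (-1)) =
      sepCount (kleinSetoid q) (level q 0 \ halves q 0) (Fintype.card m) +
        sepCount (kleinSetoid q) (level q 1 \ halves q 1) (Fintype.card m) := by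
  rw [shiftFixedTuples_sumComm, card_admissibleTuples_inter,
    Finset.sum_congr rfl fun p _ => card_separatedTuples_inter_reflectedTuples hq p]
  exact Fin.sum_univ_two fun p : ZMod 2 => sepCount _ (level q p \ halves q p) (Fintype.card m)

theorem card_shiftFixedTuples_sumComm_of_even_of_not_four_dvd (hq : 2 ∣ q) (hq4 : ¬ 4 ∣ q) {n : ℕ}
    (hn : Fintype.card m = n + 1) :
    (Nat.card (shiftFixedTuples q (Equiv.sumComm m m) (-1)) : ℚ) =
      2 * ((∏ k ∈ Finset.range n, ((q : ℚ) - (4 * k + 2))) * (q - (3 * n + 1))) := by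
  have : Nonempty m := Fintype.card_pos_iff.1 (by omega)
  obtain ⟨h, rfl⟩ := hq
  have hodd : (h : ZMod 2) = 1 := ZMod.natCast_eq_one_iff_odd.2 (by grind)
  rw [card_shiftFixedTuples_sumComm_of_even (even_two_mul h), hn, Nat.cast_add,
    sepCount_level_sdiff_halves _ (even_two_mul h), sepCount_level_sdiff_halves _ (even_two_mul h),
    ncard_halves_two_mul, ncard_halves_two_mul, ncard_torsion_of_even (dvd_mul_right 2 h),
    ncard_torsion_of_even (dvd_mul_right 2 h), hodd]
  simp only [one_ne_zero, if_true, if_false, Nat.cast_zero, Nat.cast_ofNat, sub_zero, sub_sub,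
    add_comm (2 : ℚ)]
  ring

theorem card_shiftFixedTuples_sumComm_of_four_dvd (hq : 4 ∣ q) {n : ℕ}
    (hn : Fintype.card m = n + 1) :
    (Nat.card (shiftFixedTuples q (Equiv.sumComm m m) (-1)) : ℚ) =
      2 * ((∏ k ∈ Finset.range n, ((q : ℚ) - 4 * (k + 1))) * (q - (n + 1))) := by
  have : Nonempty m := Fintype.card_pos_iff.1 (by omega)
  obtain ⟨h, rfl⟩ : 2 ∣ q := (by norm_num : 2 ∣ 4).trans hq
  have heven : (h : ZMod 2) = 0 := ZMod.natCast_eq_zero_iff_even.2 (by grind)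
  have hfour : ∏ k ∈ Finset.range n, (((2 * h : ℕ) : ℚ) - (2 + 2) - 4 * k) =
      ∏ k ∈ Finset.range n, (((2 * h : ℕ) : ℚ) - 4 * (k + 1)) :=
    Finset.prod_congr rfl fun k _ => by ring
  rw [card_shiftFixedTuples_sumComm_of_even (even_two_mul h), hn, Nat.cast_add,
    sepCount_level_sdiff_halves _ (even_two_mul h), sepCount_level_sdiff_halves _ (even_two_mul h),
    ncard_halves_two_mul, ncard_halves_two_mul, ncard_torsion_of_even (dvd_mul_right 2 h),
    ncard_torsion_of_even (dvd_mul_right 2 h), heven]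
  simp only [zero_ne_one, one_ne_zero, if_true, if_false, Nat.cast_zero, Nat.cast_ofNat, sub_zero,
    mul_zero, add_zero, sub_sub _ (2 : ℚ), hfour, prod_range_sub_mul_last]
  ring

end ReflectedTuples

section WordLength

variable {G : Type*} [Group G] {S : Set G}

theorem wordLength_prod_le {L : List G} (hL : ∀ s ∈ L, s ∈ S) : wordLength S L.prod ≤ L.length :=
  Nat.sInf_le ⟨L, hL, rfl, rfl⟩

theorem exists_list_length_eq_wordLength (hS : ∀ s ∈ S, s⁻¹ ∈ S) {w : G}
    (hw : w ∈ Subgroup.closure S) :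
    ∃ L : List G, (∀ s ∈ L, s ∈ S) ∧ L.prod = w ∧ L.length = wordLength S w := by
  have hS' : S⁻¹ ⊆ S := fun s hs => inv_inv s ▸ hS _ hs
  rw [← Subgroup.mem_toSubmonoid, Subgroup.closure_toSubmonoid,
    Set.union_eq_self_of_subset_right hS'] at hw
  obtain ⟨L, hL, hprod⟩ := Submonoid.exists_list_of_mem_closure hw
  obtain ⟨L₀, hL₀, hlength, hprod₀⟩ := Nat.sInf_mem
    (s := {n | ∃ L : List G, (∀ s ∈ L, s ∈ S) ∧ L.length = n ∧ L.prod = w}) ⟨_, L, hL, rfl, hprod⟩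
  exact ⟨L₀, hL₀, hprod₀, hlength⟩

end WordLength

section LongestElements

open RootPairing.weylGroup (ofIdx)

variable {ι M N : Type*} [AddCommGroup M] [Module ℝ M] [AddCommGroup N] [Module ℝ N]
  {P : RootPairing ι ℝ M N}

theorem weylGroup_ext {v w : P.weylGroup} (h : ∀ m : M, v • m = w • m) : v = w :=
  Subtype.ext (RootPairing.Equiv.weightHom_injective P (LinearEquiv.ext h))

theorem ofIdx_smul (i : ι) (m : M) : ofIdx P i • m = P.reflection i m := rfl

theorem ofIdx_mul_self (i : ι) : ofIdx P i * ofIdx P i = 1 :=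
  weylGroup_ext fun m => P.reflection_same i m

theorem ofIdx_inv (i : ι) : (ofIdx P i)⁻¹ = ofIdx P i :=
  inv_eq_of_mul_eq_one_left (ofIdx_mul_self i)

theorem ofIdx_mem_closure {K : Set ι} {i : ι} (hi : i ∈ K) :
    ofIdx P i ∈ Subgroup.closure (simpleReflections P K) :=
  Subgroup.subset_closure ⟨i, hi, rfl⟩

theorem weylGroupToPerm_ofIdx (i j : ι) :
    P.weylGroupToPerm (ofIdx P i) j = P.reflectionPerm i j := by
  apply P.root.injective
  rw [← P.weylGroup_apply_root, ofIdx_smul, P.root_reflectionPerm]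

theorem root_weylGroupToPerm_mul_ofIdx (w : P.weylGroup) (j : ι) :
    P.root (P.weylGroupToPerm (w * ofIdx P j) j) = -P.root (P.weylGroupToPerm w j) := by
  rw [← P.weylGroup_apply_root, ← P.weylGroup_apply_root, mul_smul,
    ofIdx_smul, P.reflection_apply_self, smul_neg]

theorem ofIdx_reflectionPerm (i j : ι) :
    ofIdx P (P.reflectionPerm i j) = ofIdx P i * ofIdx P j * ofIdx P i :=
  weylGroup_ext fun m => by
    simp only [mul_smul, ofIdx_smul, RootPairing.reflection_reflectionPerm]
    rfl

theorem prod_mul_ofIdx {K : Set ι} (j : ι) {L : List P.weylGroup}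
    (hL : ∀ s ∈ L, s ∈ simpleReflections P K) :
    L.prod * ofIdx P j = ofIdx P (P.weylGroupToPerm L.prod j) * L.prod := by
  induction L with
  | nil => simp
  | cons s L ih =>
    obtain ⟨hs, hL'⟩ := List.forall_mem_cons.1 hL
    obtain ⟨i, -, rfl⟩ := hs
    rw [List.prod_cons, map_mul, Equiv.Perm.mul_apply, weylGroupToPerm_ofIdx,
      ofIdx_reflectionPerm, mul_assoc, ih hL']
    simp only [mul_assoc]
    rw [← mul_assoc (ofIdx P i) (ofIdx P i), ofIdx_mul_self, one_mul]

variable {K : Set ι}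

theorem exists_reduced_list {w : P.weylGroup}
    (hw : w ∈ Subgroup.closure (simpleReflections P K)) :
    ∃ L : List P.weylGroup, (∀ s ∈ L, s ∈ simpleReflections P K) ∧ L.prod = w ∧
      L.length = wordLength (simpleReflections P K) w :=
  exists_list_length_eq_wordLength
    (by rintro _ ⟨i, hi, rfl⟩; exact ⟨i, hi, (ofIdx_inv i).symm⟩) hw

theorem isPos_iff_not_isPos_of_root_eq_neg (b : P.Base) {i k : ι} (h : P.root i = -P.root k) :
    b.IsPos i ↔ ¬ b.IsPos k := by
  have hi : i = P.reflectionPerm k k :=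
    P.root.injective (by rw [h, P.root_reflectionPerm, P.reflection_apply_self])
  rw [hi]
  exact RootPairing.Base.IsPos.neg_iff_not b k

variable [Finite ι] [P.IsCrystallographic] [P.IsReduced] (b : P.Base)

theorem exchange_condition (hK : K ⊆ b.support) {j : ι} (hj : j ∈ b.support)
    {L : List P.weylGroup} (hL : ∀ s ∈ L, s ∈ simpleReflections P K)
    (h : ¬ b.IsPos (P.weylGroupToPerm L.prod j)) :
    ∃ L' : List P.weylGroup, (∀ s ∈ L', s ∈ simpleReflections P K) ∧
      L'.length + 1 = L.length ∧ L.prod * ofIdx P j = L'.prod := by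
  induction L with
  | nil => exact absurd (b.isPos_of_mem_support hj) (by simpa using h)
  | cons s L ih =>
    obtain ⟨hs, hL'⟩ := List.forall_mem_cons.1 hL
    obtain ⟨i, hi, rfl⟩ := id hs
    by_cases hp : b.IsPos (P.weylGroupToPerm L.prod j)
    · have heq : P.weylGroupToPerm L.prod j = i := by
        by_contra hne
        refine h ?_
        rw [List.prod_cons, map_mul, Equiv.Perm.mul_apply, weylGroupToPerm_ofIdx]
        exact hp.reflectionPerm (hK hi) hne
      refine ⟨L, hL', rfl, ?_⟩
      rw [List.prod_cons, mul_assoc, prod_mul_ofIdx j hL', heq, ← mul_assoc, ofIdx_mul_self,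
          one_mul]
    · obtain ⟨L₀, hL₀, hlength, hprod⟩ := ih hL' hp
      exact ⟨ofIdx P i :: L₀, List.forall_mem_cons.2 ⟨hs, hL₀⟩, by simp [hlength],
        by rw [List.prod_cons, List.prod_cons, mul_assoc, hprod]⟩

theorem wordLength_mul_ofIdx_lt (hK : K ⊆ b.support) {j : ι} (hj : j ∈ b.support) {w : P.weylGroup}
    (hw : w ∈ Subgroup.closure (simpleReflections P K)) (h : ¬ b.IsPos (P.weylGroupToPerm w j)) :
    wordLength (simpleReflections P K) (w * ofIdx P j) < wordLength (simpleReflections P K) w := by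
  obtain ⟨L, hL, rfl, hlength⟩ := exists_reduced_list hw
  obtain ⟨L', hL', hlength', hprod⟩ := exchange_condition b hK hj hL h
  have := wordLength_prod_le hL'
  rw [hprod]
  omega

theorem wordLength_lt_mul_ofIdx (hK : K ⊆ b.support) {j : ι} (hj : j ∈ K) {w : P.weylGroup}
    (hw : w ∈ Subgroup.closure (simpleReflections P K)) (h : b.IsPos (P.weylGroupToPerm w j)) :
    wordLength (simpleReflections P K) w < wordLength (simpleReflections P K) (w * ofIdx P j) := by
  have hneg : ¬ b.IsPos (P.weylGroupToPerm (w * ofIdx P j) j) := by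
    rwa [isPos_iff_not_isPos_of_root_eq_neg b (root_weylGroupToPerm_mul_ofIdx w j), not_not]
  have := wordLength_mul_ofIdx_lt b hK (hK hj) (mul_mem hw (ofIdx_mem_closure hj)) hneg
  rwa [mul_assoc, ofIdx_mul_self, mul_one] at this

theorem not_isPos_of_isLongest (hK : K ⊆ b.support) {w : P.weylGroup}
    (hw : IsLongest (simpleReflections P K) w) {j : ι} (hj : j ∈ K) :
    ¬ b.IsPos (P.weylGroupToPerm w j) := fun h =>
  (wordLength_lt_mul_ofIdx b hK hj hw.1 h).not_ge (hw.2 _ (mul_mem hw.1 (ofIdx_mem_closure hj)))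

theorem eq_one_of_forall_isPos (hK : K ⊆ b.support) {w : P.weylGroup}
    (hw : w ∈ Subgroup.closure (simpleReflections P K))
    (h : ∀ j ∈ K, b.IsPos (P.weylGroupToPerm w j)) : w = 1 := by
  obtain ⟨L, hL, rfl, hlength⟩ := exists_reduced_list hw
  rcases List.eq_nil_or_concat' L with rfl | ⟨L, s, rfl⟩
  · rfl
  obtain ⟨j, hj, rfl⟩ := hL s (by simp)
  have hle := wordLength_prod_le (fun s hs => hL s (List.mem_append_left _ hs))
  have hlt : wordLength (simpleReflections P K) (L ++ [ofIdx P j]).prod <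
      wordLength (simpleReflections P K) L.prod := by
    simpa only [List.prod_append, List.prod_singleton, mul_assoc, ofIdx_mul_self, mul_one] using
      wordLength_lt_mul_ofIdx b hK hj hw (h j hj)
  rw [← hlength, List.length_append] at hlt
  omega

theorem longestElement_eq_inv [P.IsRootSystem] (hK : K ⊆ b.support) {u : P.weylGroup}
    (hu : u ∈ Subgroup.closure (simpleReflections P K))
    (h : ∀ j ∈ K, ∃ k ∈ K, u • P.root j = -P.root k) :
    longestElement (simpleReflections P K) = u⁻¹ := by
  set w := longestElement (simpleReflections P K)
  have hw : IsLongest (simpleReflections P K) w := Classical.choose_spec (exists_isLongest _)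
  refine eq_inv_iff_mul_eq_one.2 (eq_one_of_forall_isPos b hK (mul_mem hw.1 hu) fun j hj => ?_)
  obtain ⟨k, hk, hjk⟩ := h j hj
  have hroot : P.root (P.weylGroupToPerm (w * u) j) = -P.root (P.weylGroupToPerm w k) := by
    rw [← P.weylGroup_apply_root, mul_smul, hjk, smul_neg, P.weylGroup_apply_root]
  rw [isPos_iff_not_isPos_of_root_eq_neg b hroot]
  exact not_isPos_of_isLongest b hK hw hk

end LongestElements

section Frames

/-- The vectors `β` are expressed through the vectors `e` in the way in which the simple roots of
type `D` are expressed through the standard basis. -/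
structure IsFrameD {V : Type*} [AddCommGroup V] {n : ℕ} (β e : Fin (n + 2) → V) : Prop where
  castSucc : ∀ i : Fin (n + 1), β i.castSucc = e i.castSucc - e i.succ
  last : β (Fin.last _) = e (Fin.last n).castSucc + e (Fin.last _)

variable {V : Type*} [AddCommGroup V] {n : ℕ} {β e : Fin (n + 2) → V}

theorem IsFrameD.map {V' : Type*} [AddCommGroup V'] (he : IsFrameD β e) (f : V →+ V') :
    IsFrameD (f ∘ β) (f ∘ e) where
  castSucc i := by simp only [Function.comp_apply, he.castSucc i, map_sub]
  last := by simp only [Function.comp_apply, he.last, map_add]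

variable [Module ℝ V]

theorem exists_isFrameD (β : Fin (n + 2) → V) : ∃ e, IsFrameD β e := by
  let top : V := (2⁻¹ : ℝ) • (β (Fin.last _) - β (Fin.last n).castSucc)
  let e : Fin (n + 2) → V :=
    Fin.reverseInduction (motive := fun _ => V) top fun i v => β i.castSucc + v
  have hlast : e (Fin.last _) = top := Fin.reverseInduction_last ..
  have hcastSucc (i : Fin (n + 1)) : e i.castSucc = β i.castSucc + e i.succ :=
    Fin.reverseInduction_castSucc ..
  refine ⟨e, fun i => by rw [hcastSucc, add_sub_cancel_right], ?_⟩
  rw [hcastSucc, Fin.succ_last, hlast]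
  module

theorem IsFrameD.unique {e' : Fin (n + 2) → V} (he : IsFrameD β e) (he' : IsFrameD β e') :
    e = e' := by
  funext i
  induction i using Fin.reverseInduction with
  | last =>
    have hcastSucc := (he.castSucc (Fin.last n)).symm.trans (he'.castSucc _)
    have hlast := he.last.symm.trans he'.last
    rw [Fin.succ_last] at hcastSucc
    linear_combination (norm := module) (2⁻¹ : ℝ) • hlast - (2⁻¹ : ℝ) • hcastSucc
  | cast i ih =>
    have h := (he.castSucc i).symm.trans (he'.castSucc i)
    rwa [ih, sub_left_inj] at h

theorem IsFrameD.mem_span (he : IsFrameD β e) (k : Fin (n + 2)) :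
    β k ∈ Submodule.span ℝ (Set.range e) := by
  have hmem (i : Fin (n + 2)) : e i ∈ Submodule.span ℝ (Set.range e) :=
    Submodule.subset_span ⟨i, rfl⟩
  induction k using Fin.lastCases with
  | last => exact he.last ▸ add_mem (hmem _) (hmem _)
  | cast i => exact he.castSucc i ▸ sub_mem (hmem _) (hmem _)

theorem isFrameD_cartanMatrix_castSucc (k : Fin (n + 1)) :
    IsFrameD (fun i => (CartanMatrix.D (n + 2) i k.castSucc : ℝ))
      fun i => if i = k.castSucc then 1 else if i = k.succ then -1 else 0 := by
  constructor
  · intro i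
    simp only [CartanMatrix.D, Matrix.of_apply, Fin.ext_iff, Fin.val_castSucc, Fin.val_succ]
    split_ifs <;> grind
  · simp only [CartanMatrix.D, Matrix.of_apply, Fin.ext_iff, Fin.val_castSucc, Fin.val_succ,
      Fin.val_last]
    split_ifs <;> grind

theorem isFrameD_cartanMatrix_last :
    IsFrameD (fun i => (CartanMatrix.D (n + 2) i (Fin.last _) : ℝ))
      fun i => if i = (Fin.last n).castSucc ∨ i = Fin.last _ then 1 else 0 := by
  constructor
  · intro i
    simp only [CartanMatrix.D, Matrix.of_apply, Fin.ext_iff, Fin.val_castSucc, Fin.val_succ,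
      Fin.val_last]
    split_ifs <;> grind
  · simp only [CartanMatrix.D, Matrix.of_apply, Fin.ext_iff, Fin.val_castSucc, Fin.val_last]
    split_ifs <;> grind

end Frames

section SignedPermutations

/-- The group element `w` permutes the vectors `e` up to signs, by the permutation `σ` and the
signs `ε`. -/
def ActsSigned {W V κ : Type*} [AddCommGroup V] [SMul W V] (e : κ → V) (w : W)
    (σ : Equiv.Perm κ) (ε : κ → ℤˣ) : Prop :=
  ∀ i, w • e i = ε i • e (σ i)

variable {W V κ : Type*} [AddCommGroup V] [Group W] [DistribMulAction W V] {e : κ → V}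

theorem ActsSigned.mul {v w : W} {σ τ : Equiv.Perm κ} {ε δ : κ → ℤˣ} (hv : ActsSigned e v σ ε)
    (hw : ActsSigned e w τ δ) : ActsSigned e (v * w) (σ * τ) (δ * ε ∘ τ) := fun i => by
  rw [mul_smul, hw i, smul_comm, hv (τ i), smul_smul]
  rfl

theorem exists_actsSigned_perm {n : ℕ} {e : Fin (n + 1) → V} {H : Subgroup W}
    (h : ∀ i : Fin n, ∃ w ∈ H, ActsSigned e w (Equiv.swap i.castSucc i.succ) 1)
    (σ : Equiv.Perm (Fin (n + 1))) : ∃ w ∈ H, ActsSigned e w σ 1 := by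
  induction (Equiv.Perm.mclosure_swap_castSucc_succ n).ge (Submonoid.mem_top σ) using
    Submonoid.closure_induction with
  | mem _ hσ =>
    obtain ⟨i, rfl⟩ := hσ
    exact h i
  | one => exact ⟨1, one_mem H, fun i => by simp⟩
  | mul _ _ _ _ hσ hτ =>
    obtain ⟨v, hvH, hv⟩ := hσ
    obtain ⟨w, hwH, hw⟩ := hτ
    exact ⟨v * w, mul_mem hvH hwH, by simpa using hv.mul hw⟩

/-- The sign vectors `ε` such that some element of `H` multiplies each `e i` by `ε i`. -/
def diagonalSigns (H : Subgroup W) (e : κ → V) : Submonoid (κ → ℤˣ) where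
  carrier := {ε | ∃ w ∈ H, ActsSigned e w 1 ε}
  one_mem' := ⟨1, one_mem H, fun i => by simp⟩
  mul_mem' := by
    rintro ε δ ⟨v, hvH, hv⟩ ⟨w, hwH, hw⟩
    exact ⟨v * w, mul_mem hvH hwH, by simpa [mul_comm] using hv.mul hw⟩

theorem comp_mem_diagonalSigns {H : Subgroup W} {ε : κ → ℤˣ} (hε : ε ∈ diagonalSigns H e) {w : W}
    (hwH : w ∈ H) {σ : Equiv.Perm κ} (hw : ActsSigned e w σ 1) : ε ∘ σ ∈ diagonalSigns H e := by
  obtain ⟨v, hvH, hv⟩ := hε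
  refine ⟨w⁻¹ * v * w, mul_mem (mul_mem (inv_mem hwH) hvH) hwH, fun i => ?_⟩
  have hwi : w • e i = e (σ i) := by simpa using hw i
  rw [mul_smul, mul_smul, inv_smul_eq_iff, hwi, hv (σ i), smul_comm w, Equiv.Perm.one_apply,
    Equiv.Perm.one_apply, hwi]
  rfl

variable {n : ℕ}

theorem prod_negPair_last (hn : Even n) :
    ∏ k : Fin (n + 1), negPair k.castSucc (Fin.last (n + 1)) = -1 := by
  funext i
  rw [Finset.prod_apply]
  induction i using Fin.lastCases with
  | last => simp [negPair, hn.add_one.neg_one_pow]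
  | cast i => simp [negPair, Finset.prod_ite_eq, Fin.castSucc_ne_last]

theorem prod_negPair_succ_last (hn : Even n) :
    ∏ k : Fin n, negPair k.succ.castSucc (Fin.last (n + 1)) = -negPair 0 (Fin.last (n + 1)) := by
  have hsq : negPair 0 (Fin.last (n + 1)) * negPair 0 (Fin.last (n + 1)) = 1 :=
    funext fun i => Int.units_mul_self _
  rw [← one_mul (∏ k : Fin n, _), ← hsq, mul_assoc]
  have h := prod_negPair_last hn
  rw [Fin.prod_univ_succ, Fin.castSucc_zero] at h
  rw [h, mul_neg, mul_one]

end SignedPermutations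

section SimpleReflectionsD

open RootPairing.weylGroup (ofIdx)

variable {ι M N : Type*} [AddCommGroup M] [Module ℝ M] [AddCommGroup N] [Module ℝ N]
  {P : RootPairing ι ℝ M N} [P.IsCrystallographic] {b : P.Base} {n : ℕ}
  {α : Fin (n + 2) ≃ b.support} {e : Fin (n + 2) → M}

theorem IsLabellingD.coroot'_root (hD : IsLabellingD b (n + 2) α) (i k : Fin (n + 2)) :
    P.coroot' (α k) (P.root (α i)) = CartanMatrix.D (n + 2) i k := by
  rw [← hD i k, RootPairing.root_coroot'_eq_pairing]
  exact (P.algebraMap_pairingIn ℤ _ _).symm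

variable (hD : IsLabellingD b (n + 2) α) (he : IsFrameD (fun k => P.root (α k)) e)
include hD he

theorem coroot'_frame {k : Fin (n + 2)} {c : Fin (n + 2) → ℝ}
    (hc : IsFrameD (fun i => (CartanMatrix.D (n + 2) i k : ℝ)) c) (i : Fin (n + 2)) :
    P.coroot' (α k) (e i) = c i := by
  simp only [← hD.coroot'_root] at hc
  exact congrFun ((he.map (P.coroot' (α k)).toAddMonoidHom).unique hc) i

theorem actsSigned_ofIdx_castSucc (k : Fin (n + 1)) :
    ActsSigned e (ofIdx P (α k.castSucc)) (Equiv.swap k.castSucc k.succ) 1 := fun i => by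
  rw [ofIdx_smul, P.reflection_apply, coroot'_frame hD he (isFrameD_cartanMatrix_castSucc k),
    he.castSucc, Pi.one_apply, one_smul, Equiv.swap_apply_def]
  split_ifs <;> simp [*]

theorem actsSigned_ofIdx_last :
    ActsSigned e (ofIdx P (α (Fin.last _)))
      (Equiv.swap (Fin.last n).castSucc (Fin.last (n + 1)))
      (negPair (Fin.last n).castSucc (Fin.last (n + 1))) := fun i => by
  rw [ofIdx_smul, P.reflection_apply, coroot'_frame hD he isFrameD_cartanMatrix_last, he.last,
    negPair, Equiv.swap_apply_def]
  split_ifs <;> simp_all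

theorem exists_actsSigned_ofIdx (k : Fin (n + 2)) :
    ∃ σ ε, ActsSigned e (ofIdx P (α k)) σ ε := by
  induction k using Fin.lastCases with
  | last => exact ⟨_, _, actsSigned_ofIdx_last hD he⟩
  | cast k => exact ⟨_, _, actsSigned_ofIdx_castSucc hD he k⟩

theorem negPair_mem_diagonalSigns {H : Subgroup P.weylGroup} (j : Fin (n + 1))
    (hH : ∀ i, j.castSucc ≤ i → ofIdx P (α i) ∈ H) :
    negPair j.castSucc (Fin.last (n + 1)) ∈ diagonalSigns H e := by
  induction j using Fin.reverseInduction with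
  | last =>
    have h := (actsSigned_ofIdx_last hD he).mul (actsSigned_ofIdx_castSucc hD he (Fin.last n))
    refine ⟨_, mul_mem (hH _ (Fin.le_last _)) (hH _ le_rfl), ?_⟩
    convert h using 1
    · rw [Fin.succ_last, Equiv.swap_mul_self]
    · funext i
      simp only [one_mul, Function.comp_apply, negPair, Fin.succ_last, Equiv.swap_apply_def]
      split_ifs <;> simp_all
  | cast k ih =>
    have hle : k.castSucc.castSucc ≤ k.succ.castSucc := by simp [Fin.le_def]
    have h := comp_mem_diagonalSigns (ih fun i hi => hH i (hle.trans hi)) (hH _ le_rfl)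
      (actsSigned_ofIdx_castSucc hD he k.castSucc)
    convert h using 1
    funext i
    simp only [Function.comp_apply, negPair, Equiv.swap_apply_def, ← Fin.succ_castSucc]
    split_ifs <;> simp_all [Fin.ext_iff] <;> omega

end SimpleReflectionsD

section RootsD

open RootPairing.weylGroup (ofIdx)

/-- The vectors `± e i ± e j` for `i ≠ j`: the roots of type `D` if `e` is the standard basis. -/
def typeDVectors {V κ : Type*} [AddCommGroup V] (e : κ → V) : Set V :=
  {m | ∃ i j, i ≠ j ∧ ∃ ε δ : ℤˣ, m = ε • e i + δ • e j}

theorem neg_mem_typeDVectors {V κ : Type*} [AddCommGroup V] {e : κ → V} {m : V}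
    (hm : m ∈ typeDVectors e) : -m ∈ typeDVectors e := by
  obtain ⟨i, j, hij, ε, δ, rfl⟩ := hm
  exact ⟨i, j, hij, -ε, -δ, by rw [neg_add, Units.neg_smul, Units.neg_smul]⟩

theorem ActsSigned.smul_mem_typeDVectors {W V κ : Type*} [AddCommGroup V] [Group W]
    [DistribMulAction W V] {e : κ → V} {w : W} {σ : Equiv.Perm κ} {ε : κ → ℤˣ}
    (hw : ActsSigned e w σ ε) {m : V} (hm : m ∈ typeDVectors e) : w • m ∈ typeDVectors e := by
  obtain ⟨i, j, hij, δ, δ', rfl⟩ := hm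
  refine ⟨σ i, σ j, σ.injective.ne hij, δ * ε i, δ' * ε j, ?_⟩
  rw [smul_add, smul_comm w δ, smul_comm w δ', hw i, hw j, mul_smul, mul_smul]

theorem IsFrameD.mem_typeDVectors {V : Type*} [AddCommGroup V] {n : ℕ} {β e : Fin (n + 2) → V}
    (he : IsFrameD β e) (k : Fin (n + 2)) : β k ∈ typeDVectors e := by
  induction k using Fin.lastCases with
  | last => exact ⟨_, _, (Fin.castSucc_lt_last _).ne, 1, 1, by rw [he.last, one_smul, one_smul]⟩
  | cast k =>
    exact ⟨_, _, Fin.castSucc_lt_succ.ne, 1, -1, by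
      rw [he.castSucc, one_smul, Units.neg_smul, one_smul, sub_eq_add_neg]⟩

variable {ι M N : Type*} [AddCommGroup M] [Module ℝ M] [AddCommGroup N] [Module ℝ N]
  {P : RootPairing ι ℝ M N}

theorem neg_mem_range_root {m : M} (hm : m ∈ Set.range P.root) : -m ∈ Set.range P.root := by
  obtain ⟨r, rfl⟩ := hm
  exact ⟨P.reflectionPerm r r, by rw [P.root_reflectionPerm, P.reflection_apply_self]⟩

variable [P.IsCrystallographic] {b : P.Base} {n : ℕ} {α : Fin (n + 2) ≃ b.support}
  {e : Fin (n + 2) → M} (hD : IsLabellingD b (n + 2) α) (he : IsFrameD (fun k => P.root (α k)) e)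
include hD he

theorem range_root_subset [Finite ι] [P.IsReduced] : Set.range P.root ⊆ typeDVectors e := by
  rintro _ ⟨r, rfl⟩
  induction r using b.induction_reflect with
  | h₀ r hr =>
    rw [P.root_reflectionPerm, P.reflection_apply_self]
    exact neg_mem_typeDVectors hr
  | h₁ r hr =>
    obtain ⟨k, hk⟩ := α.surjective ⟨r, hr⟩
    simpa only [hk] using he.mem_typeDVectors k
  | h₂ r s hr hs =>
    obtain ⟨k, hk⟩ := α.surjective ⟨s, hs⟩
    obtain ⟨σ, ε, hw⟩ := exists_actsSigned_ofIdx hD he k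
    rw [P.root_reflectionPerm, ← ofIdx_smul]
    simpa only [hk] using hw.smul_mem_typeDVectors hr

theorem add_mem_range_root {ε δ : ℤˣ} {a c : Fin (n + 2)} (hac : a ≠ c)
    (h : ε • e a + δ • e c ∈ Set.range P.root) {i j : Fin (n + 2)} (hij : i ≠ j) :
    ε • e i + δ • e j ∈ Set.range P.root := by
  obtain ⟨σ, rfl, rfl⟩ : ∃ σ : Equiv.Perm (Fin (n + 2)), σ a = i ∧ σ c = j :=
    MulAction.is_two_pretransitive_iff.1 (Equiv.Perm.isMultiplyPretransitive _ 2) hac hij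
  obtain ⟨w, -, hw⟩ := exists_actsSigned_perm (H := ⊤)
    (fun k => ⟨_, Subgroup.mem_top _, actsSigned_ofIdx_castSucc hD he k⟩) σ
  obtain ⟨r, hr⟩ := h
  refine ⟨P.weylGroupToPerm w r, ?_⟩
  rw [← P.weylGroup_apply_root, hr, smul_add, smul_comm w ε, smul_comm w δ, hw a, hw c]
  simp only [Pi.one_apply, one_smul]

theorem range_root_eq_typeDVectors [Finite ι] [P.IsReduced] :
    Set.range P.root = typeDVectors e := by
  refine (range_root_subset hD he).antisymm ?_
  have hsum {i j : Fin (n + 2)} (hij : i ≠ j) :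
      (1 : ℤˣ) • e i + (1 : ℤˣ) • e j ∈ Set.range P.root :=
    add_mem_range_root hD he (Fin.castSucc_lt_last (Fin.last n)).ne
      ⟨α (Fin.last _), by simp only [he.last, one_smul]⟩ hij
  have hdiff {i j : Fin (n + 2)} (hij : i ≠ j) :
      (1 : ℤˣ) • e i + (-1 : ℤˣ) • e j ∈ Set.range P.root :=
    add_mem_range_root hD he (Fin.castSucc_lt_succ (i := 0)).ne
      ⟨α (Fin.castSucc 0), by
        simp only [he.castSucc, one_smul, Units.neg_smul, sub_eq_add_neg]⟩ hij
  rintro _ ⟨i, j, hij, ε, δ, rfl⟩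
  obtain rfl | rfl := Int.units_eq_one_or ε <;> obtain rfl | rfl := Int.units_eq_one_or δ
  · exact hsum hij
  · exact hdiff hij
  · exact add_comm ((1 : ℤˣ) • e j) _ ▸ hdiff hij.symm
  · simpa only [Units.neg_smul, neg_add] using neg_mem_range_root (hsum hij)

omit hD [P.IsCrystallographic] in
theorem exists_basis_eq_frame [P.IsRootSystem] :
    ∃ B : Module.Basis (Fin (n + 2)) ℝ M, ⇑B = e := by
  have hspan : ⊤ ≤ Submodule.span ℝ (Set.range e) := by
    rw [← b.toWeightBasis.span_eq, Submodule.span_le]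
    rintro _ ⟨s, rfl⟩
    obtain ⟨k, rfl⟩ := α.surjective s
    rw [b.toWeightBasis_apply]
    exact he.mem_span k
  have hcard : Fintype.card (Fin (n + 2)) = Module.finrank ℝ M := by
    rw [Module.finrank_eq_card_basis b.toWeightBasis, Fintype.card_congr α]
  exact ⟨basisOfTopLeSpanOfCardEqFinrank e hspan hcard,
    coe_basisOfTopLeSpanOfCardEqFinrank e hspan hcard⟩

end RootsD

section OmegaD

open RootPairing.weylGroup (ofIdx)

variable {ι M N : Type*} [AddCommGroup M] [Module ℝ M] [AddCommGroup N] [Module ℝ N]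
  {P : RootPairing ι ℝ M N} {b : P.Base}

theorem support_eq_range {κ : Type*} (α : κ ≃ b.support) :
    (b.support : Set ι) = Set.range fun k => (α k : ι) :=
  Set.ext fun s => ⟨fun hs => ⟨α.symm ⟨s, hs⟩, by simp⟩, by rintro ⟨k, rfl⟩; exact (α k).2⟩

theorem support_diff_eq_image {κ : Type*} (α : κ ≃ b.support) (j : κ) :
    (b.support : Set ι) \ {(α j : ι)} = (fun k => (α k : ι)) '' {j}ᶜ := by
  have hα : Function.Injective fun k => (α k : ι) := Subtype.val_injective.comp α.injective
  rw [Set.image_compl_eq_range_sdiff_image hα, ← support_eq_range, Set.image_singleton]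

variable [P.IsCrystallographic] [Finite ι] [P.IsReduced] [P.IsRootSystem] {n : ℕ}
  {α : Fin (n + 2) ≃ b.support} {e : Fin (n + 2) → M} (hD : IsLabellingD b (n + 2) α)
  (he : IsFrameD (fun k => P.root (α k)) e) (hn : Even n)
include hD he hn

theorem actsSigned_inv_longestElement_support :
    ActsSigned e (longestElement (simpleReflections P (b.support : Set ι)))⁻¹ 1 (-1) := by
  obtain ⟨u, huH, hu⟩ : -1 ∈
      diagonalSigns (Subgroup.closure (simpleReflections P (b.support : Set ι))) e := by
    rw [← prod_negPair_last hn]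
    exact prod_mem fun k _ => negPair_mem_diagonalSigns hD he k fun i _ =>
      ofIdx_mem_closure (α i).2
  have hneg (i : Fin (n + 2)) : u • e i = -e i := by simpa using hu i
  rwa [longestElement_eq_inv b subset_rfl huH, inv_inv]
  rw [support_eq_range α]
  rintro _ ⟨k, rfl⟩
  refine ⟨α k, ⟨k, rfl⟩, ?_⟩
  induction k using Fin.lastCases with
  | last => rw [he.last, smul_add, hneg, hneg, neg_add]
  | cast k => rw [he.castSucc, smul_sub, hneg, hneg, neg_sub_neg, neg_sub]

theorem actsSigned_omega_inv {j : Fin (n + 2)} {u : P.weylGroup}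
    (huH : u ∈ Subgroup.closure (simpleReflections P ((fun k => (α k : ι)) '' {j}ᶜ)))
    (huroot : ∀ k ≠ j, ∃ l ≠ j, u • P.root (α k) = -P.root (α l))
    {σ : Equiv.Perm (Fin (n + 2))} {ε : Fin (n + 2) → ℤˣ} (hu : ActsSigned e u σ (-ε)) :
    ActsSigned e (omega b (α j))⁻¹ σ ε := by
  have hsub : (fun k => (α k : ι)) '' {j}ᶜ ⊆ b.support := by
    rw [← support_diff_eq_image]
    exact Set.sdiff_subset
  rw [omega, mul_inv_rev, support_diff_eq_image, longestElement_eq_inv b hsub huH, inv_inv]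
  · have h := (actsSigned_inv_longestElement_support hD he hn).mul hu
    rw [one_mul] at h
    convert h using 1
    funext i
    simp
  · rintro _ ⟨k, hk, rfl⟩
    obtain ⟨l, hl, hkl⟩ := huroot k hk
    exact ⟨α l, ⟨l, hl, rfl⟩, hkl⟩

theorem actsSigned_omega_zero_inv (hn0 : n ≠ 0) :
    ActsSigned e (omega b (α 0))⁻¹ 1 (negPair 0 (Fin.last (n + 1))) := by
  obtain ⟨u, huH, hu⟩ : -negPair 0 (Fin.last (n + 1)) ∈ diagonalSigns
      (Subgroup.closure (simpleReflections P ((fun k => (α k : ι)) '' {0}ᶜ))) e := by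
    rw [← prod_negPair_succ_last hn]
    refine prod_mem fun k _ => negPair_mem_diagonalSigns hD he k.succ fun i hi =>
      ofIdx_mem_closure ⟨i, ?_, rfl⟩
    exact ((Fin.succ_pos k.castSucc).trans_le hi).ne'
  refine actsSigned_omega_inv hD he hn huH (fun k hk => ?_) hu
  have hlast : u • e (Fin.last (n + 1)) = e (Fin.last (n + 1)) := by
    simpa [negPair] using hu (Fin.last _)
  have hneg {i : Fin (n + 2)} (hi : i ≠ 0) (hi' : i ≠ Fin.last _) : u • e i = -e i := by
    simpa [negPair, hi, hi'] using hu i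
  have : NeZero n := ⟨hn0⟩
  have hne : (Fin.last n).castSucc ≠ 0 := by simpa [Fin.ext_iff] using hn0
  have hne' : (Fin.last n).castSucc ≠ Fin.last (n + 1) := (Fin.castSucc_lt_last _).ne
  induction k using Fin.lastCases with
  | last =>
    refine ⟨(Fin.last n).castSucc, hne, ?_⟩
    rw [he.last, he.castSucc, smul_add, hneg hne hne', Fin.succ_last, hlast, neg_sub,
      neg_add_eq_sub]
  | cast k =>
    induction k using Fin.lastCases with
    | last =>
      refine ⟨Fin.last _, (Fin.last_pos).ne', ?_⟩
      rw [he.last, he.castSucc, smul_sub, hneg hne hne', Fin.succ_last, hlast, neg_add']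
    | cast k =>
      refine ⟨_, hk, ?_⟩
      rw [he.castSucc, smul_sub, hneg hk (Fin.castSucc_lt_last _).ne, Fin.succ_castSucc,
        hneg (Fin.castSucc_ne_zero_iff.2 (Fin.succ_ne_zero k)) (Fin.castSucc_lt_last _).ne,
        neg_sub_neg, neg_sub]

theorem actsSigned_omega_last_inv :
    ActsSigned e (omega b (α (Fin.last _)))⁻¹ Fin.revPerm (-1) := by
  obtain ⟨u, huH, hu⟩ := exists_actsSigned_perm (e := e)
    (H := Subgroup.closure (simpleReflections P ((fun k => (α k : ι)) '' {Fin.last (n + 1)}ᶜ)))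
    (fun k => ⟨_, ofIdx_mem_closure ⟨_, (Fin.castSucc_lt_last k).ne, rfl⟩,
      actsSigned_ofIdx_castSucc hD he k⟩) Fin.revPerm
  refine actsSigned_omega_inv hD he hn huH (fun k hk => ?_) (by rwa [neg_neg])
  obtain ⟨k, rfl⟩ := Fin.exists_castSucc_eq.2 hk
  have hrev (i : Fin (n + 2)) : u • e i = e i.rev := by simpa using hu i
  refine ⟨k.rev.castSucc, (Fin.castSucc_lt_last _).ne, ?_⟩
  rw [he.castSucc, he.castSucc, smul_sub, hrev, hrev, Fin.rev_castSucc, Fin.rev_succ, neg_sub]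

end OmegaD

section CardImagePreimage

theorem natCard_image_preimage_mk {A B : Type*} [AddCommGroup A] [AddCommGroup B] (f : A →+ B)
    {H : AddSubgroup A} (hf : f.ker ≤ H) (F : Set (A ⧸ H)) :
    Nat.card (f '' (QuotientAddGroup.mk ⁻¹' F)) = Nat.card F * Nat.card (H.map f) := by
  let g : A ⧸ H →+ B ⧸ H.map f := QuotientAddGroup.map H (H.map f) f (H.le_comap_map f)
  have hg : Function.Injective g := by
    refine (injective_iff_map_eq_zero g).2 fun y hy => ?_
    obtain ⟨a, rfl⟩ := QuotientAddGroup.mk_surjective y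
    rw [QuotientAddGroup.eq_zero_iff, ← AddSubgroup.comap_map_eq_self hf]
    exact (QuotientAddGroup.eq_zero_iff (f a)).1 hy
  have himage : f '' (QuotientAddGroup.mk ⁻¹' F) = QuotientAddGroup.mk ⁻¹' (g '' F) := by
    ext b
    constructor
    · rintro ⟨a, ha, rfl⟩
      exact ⟨a, ha, rfl⟩
    · rintro ⟨y, hy, hyb⟩
      obtain ⟨a, rfl⟩ := QuotientAddGroup.mk_surjective y
      obtain ⟨h, hh, hhb⟩ := QuotientAddGroup.eq.1 hyb
      exact ⟨a + h, by simpa [QuotientAddGroup.mk_add_of_mem a hh], by rw [map_add, hhb]; abel⟩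
  rw [himage, Nat.card_congr (QuotientAddGroup.preimageMkEquivAddSubgroupProdSet _ _),
    Nat.card_prod, Nat.card_image_of_injective hg, mul_comm]

end CardImagePreimage

section DoubledCoordinates

variable {ι M N κ : Type*} [AddCommGroup M] [Module ℝ M] [AddCommGroup N] [Module ℝ N]
  {P : RootPairing ι ℝ M N}

theorem mk_mem_complement_iff {q : ℕ} {x : coweightLattice P} :
    (x : LatticeMod P q) ∈ complement P q ↔ ∀ i, ¬ ∃ k : ℤ, P.root' i (x : N) = (q : ℝ) * k := by
  refine ⟨?_, fun h => ⟨x, rfl, h⟩⟩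
  rintro ⟨x', hx', h⟩ i ⟨k, hk⟩
  obtain ⟨z, hz⟩ := QuotientAddGroup.eq.1 hx'
  obtain ⟨m, hm⟩ := z.2 i
  refine h i ⟨k - m, ?_⟩
  obtain rfl : x = x' + q • z := by rw [← neg_add_eq_iff_eq_add]; exact hz.symm
  push_cast [map_add, map_nsmul, hm, nsmul_eq_mul] at hk ⊢
  linarith

variable [Nontrivial κ] {e : κ → M} (he : typeDVectors e ⊆ Set.range P.root)
include he

theorem exists_intCast_eq_two_mul (x : coweightLattice P) (i : κ) :
    ∃ m : ℤ, (m : ℝ) = 2 * P.toLinearMap (e i) x := by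
  obtain ⟨j, hij⟩ := exists_ne i
  obtain ⟨r, hr⟩ := he ⟨i, j, hij.symm, 1, 1, rfl⟩
  obtain ⟨s, hs⟩ := he ⟨i, j, hij.symm, 1, -1, rfl⟩
  obtain ⟨m, hm⟩ := x.2 r
  obtain ⟨n, hn⟩ := x.2 s
  refine ⟨m + n, ?_⟩
  rw [Int.cast_add, ← hm, ← hn, ← LinearMap.add_apply, RootPairing.root', RootPairing.root',
    ← map_add, hr, hs, Units.neg_smul, one_smul, one_smul, add_add_add_comm, add_neg_cancel,
    add_zero, ← two_smul ℝ, map_smul, LinearMap.smul_apply, smul_eq_mul]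

theorem coe_floor_two_mul (x : coweightLattice P) (i : κ) :
    (⌊2 * P.toLinearMap (e i) (x : N)⌋ : ℝ) = 2 * P.toLinearMap (e i) x := by
  obtain ⟨m, hm⟩ := exists_intCast_eq_two_mul he x i
  rw [← hm, Int.floor_intCast]

omit he in
/-- The coordinates dual to `e` of an element of the coweight lattice, multiplied by `2`: the
coordinates themselves are half-integers, and the floor only serves to read twice their values as
integers. -/
def doubledCoords (he : typeDVectors e ⊆ Set.range P.root) : coweightLattice P →+ κ → ℤ :=
  AddMonoidHom.mk' (fun x i => ⌊2 * P.toLinearMap (e i) (x : N)⌋) fun x y => funext fun i => by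
    rw [← @Int.cast_inj ℝ, Pi.add_apply, Int.cast_add, coe_floor_two_mul he, coe_floor_two_mul he,
      coe_floor_two_mul he, AddSubgroup.coe_add, map_add, mul_add]

theorem coe_doubledCoords (x : coweightLattice P) (i : κ) :
    (doubledCoords he x i : ℝ) = 2 * P.toLinearMap (e i) x :=
  coe_floor_two_mul he x i

theorem coe_units_smul_doubledCoords (x : coweightLattice P) (i : κ) (ε : ℤˣ) :
    ((ε • doubledCoords he x i : ℤ) : ℝ) = 2 * P.toLinearMap (ε • e i) x := by
  rw [Units.smul_def, Units.smul_def, map_zsmul, LinearMap.smul_apply, smul_eq_mul, Int.cast_mul,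
    coe_doubledCoords, zsmul_eq_mul, mul_left_comm]

theorem doubledCoords_smul {w : P.weylGroup} {σ : Equiv.Perm κ} {ε : κ → ℤˣ}
    (hw : ActsSigned e w⁻¹ σ ε) (x : coweightLattice P) (i : κ) :
    doubledCoords he (w • x) i = ε i • doubledCoords he x (σ i) := by
  rw [← @Int.cast_inj ℝ, coe_units_smul_doubledCoords, coe_doubledCoords, ← hw i]
  exact congrArg (2 * ·) (pairing_coweightAct P w (e i) x)

theorem two_dvd_doubledCoords_sub (x : coweightLattice P) (i j : κ) :
    2 ∣ doubledCoords he x i - doubledCoords he x j := by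
  obtain rfl | hij := eq_or_ne i j
  · simp
  obtain ⟨r, hr⟩ := he ⟨i, j, hij, 1, -1, rfl⟩
  obtain ⟨m, hm⟩ := x.2 r
  refine ⟨m, ?_⟩
  rw [← @Int.cast_inj ℝ, Int.cast_mul, Int.cast_sub, ← hm, RootPairing.root', hr,
    coe_doubledCoords, coe_doubledCoords, one_smul, Units.neg_smul, one_smul, map_add, map_neg,
    LinearMap.add_apply, LinearMap.neg_apply]
  push_cast
  ring

/-- The doubled coordinates modulo `2 * q`. -/
def residues (q : ℕ) : coweightLattice P →+ κ → ZMod (2 * q) :=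
  ((Int.castAddHom (ZMod (2 * q))).compLeft κ).comp (doubledCoords he)

variable {q : ℕ}

theorem residues_smul {w : P.weylGroup} {σ : Equiv.Perm κ} {ε : κ → ℤˣ}
    (hw : ActsSigned e w⁻¹ σ ε) (x : coweightLattice P) (i : κ) :
    residues he q (w • x) i = ε i • residues he q x (σ i) := by
  change ((doubledCoords he (w • x) i : ℤ) : ZMod (2 * q)) = ε i • (doubledCoords he x (σ i) : ℤ)
  rw [doubledCoords_smul he hw, Units.smul_def, Units.smul_def, smul_eq_mul, zsmul_eq_mul,
    Int.cast_mul]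

theorem exists_eq_mul_iff_residues (x : coweightLattice P) (i j : κ) (ε δ : ℤˣ) :
    (∃ k : ℤ, P.toLinearMap (ε • e i + δ • e j) (x : N) = (q : ℝ) * k) ↔
      ε • residues he q x i + δ • residues he q x j = 0 := by
  have hcast : ε • residues he q x i + δ • residues he q x j =
      ((ε • doubledCoords he x i + δ • doubledCoords he x j : ℤ) : ZMod (2 * q)) := by
    simp only [Units.smul_def, zsmul_eq_mul, smul_eq_mul, Int.cast_add, Int.cast_mul]
    rfl
  rw [hcast, ZMod.intCast_zmod_eq_zero_iff_dvd]
  refine exists_congr fun k => ?_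
  rw [← @Int.cast_inj ℝ, Int.cast_add, coe_units_smul_doubledCoords, coe_units_smul_doubledCoords,
    map_add, LinearMap.add_apply]
  push_cast
  constructor <;> intro h <;> linarith

theorem parity_residues (x : coweightLattice P) (i j : κ) :
    parity q (residues he q x i) = parity q (residues he q x j) := by
  change parity q (doubledCoords he x i : ℤ) = parity q (doubledCoords he x j : ℤ)
  rw [map_intCast, map_intCast, ZMod.intCast_eq_intCast_iff_dvd_sub]
  exact_mod_cast two_dvd_doubledCoords_sub he x j i

end DoubledCoordinates

section FixedClasses

variable {ι M N κ : Type*} [AddCommGroup M] [Module ℝ M] [AddCommGroup N] [Module ℝ N]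
  {P : RootPairing ι ℝ M N} [Nontrivial κ] {e : κ → M}
  (hroots : Set.range P.root = typeDVectors e) {q : ℕ}
include hroots

theorem residues_mem_admissibleTuples_iff (x : coweightLattice P) :
    residues hroots.ge q x ∈ admissibleTuples q κ ↔ (x : LatticeMod P q) ∈ complement P q := by
  have hroot (i j : κ) (hij : i ≠ j) (ε δ : ℤˣ) : ∃ r, P.root r = ε • e i + δ • e j :=
    hroots.ge ⟨i, j, hij, ε, δ, rfl⟩
  have hval {r : ι} {i j : κ} {ε δ : ℤˣ} (hr : P.root r = ε • e i + δ • e j) :=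
    hr ▸ exists_eq_mul_iff_residues hroots.ge (q := q) x i j ε δ
  rw [mk_mem_complement_iff]
  constructor
  · rintro ⟨-, h⟩ r hr
    obtain ⟨i, j, hij, ε, δ, hεδ⟩ := hroots.le ⟨r, rfl⟩
    have h0 := (hval hεδ).1 hr
    refine h hij ?_
    rw [negSetoid_iff]
    obtain rfl | rfl := Int.units_eq_one_or ε <;> obtain rfl | rfl := Int.units_eq_one_or δ <;>
      simp only [one_smul, Units.neg_smul] at h0
    · exact Or.inr (eq_neg_of_add_eq_zero_left h0)
    · exact Or.inl (add_neg_eq_zero.1 h0)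
    · exact Or.inl (neg_add_eq_zero.1 h0)
    · exact Or.inr (neg_eq_iff_add_eq_zero.2 (by linear_combination -h0)).symm
  · refine fun h => ⟨parity_residues hroots.ge x, fun i j hij hneg => ?_⟩
    obtain ⟨r, hr⟩ := hroot i j hij 1 1
    obtain ⟨s, hs⟩ := hroot i j hij 1 (-1)
    rw [negSetoid_iff] at hneg
    obtain h0 | h0 := hneg
    · exact h s ((hval hs).2 (by rw [h0, one_smul, Units.neg_smul, one_smul, add_neg_cancel]))
    · exact h r ((hval hr).2 (by rw [h0, one_smul, one_smul, neg_add_cancel]))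

variable {B : Module.Basis κ ℝ M} (hB : ⇑B = e)
include hB

theorem doubledCoords_injective : Function.Injective (doubledCoords hroots.ge) := by
  intro x y hxy
  refine Subtype.ext ((LinearMap.IsPerfPair.bijective_right P.toLinearMap).1 (B.ext fun i => ?_))
  have h := congrArg (Int.cast (R := ℝ)) (congrFun hxy i)
  rw [coe_doubledCoords, coe_doubledCoords] at h
  rw [hB]
  exact mul_left_cancel₀ two_ne_zero h

theorem exists_doubledCoords_eq {v : κ → ℤ} (hv : ∀ i j, 2 ∣ v i - v j) :
    ∃ x, doubledCoords hroots.ge x = v := by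
  obtain ⟨x, hx⟩ := (LinearMap.IsPerfPair.bijective_right P.toLinearMap).2
    (B.constr ℝ fun i => (v i : ℝ) / 2)
  have hxe (i : κ) : P.toLinearMap (e i) x = v i / 2 := by
    rw [← hB, ← B.constr_basis ℝ (fun i => (v i : ℝ) / 2) i, ← hx]
    rfl
  have hmem : x ∈ coweightLattice P := fun r => by
    obtain ⟨i, j, -, ε, δ, hr⟩ := hroots.le ⟨r, rfl⟩
    obtain ⟨c, hc⟩ : 2 ∣ (ε : ℤ) * v i + δ * v j := by
      have := hv i j
      obtain rfl | rfl := Int.units_eq_one_or ε <;> obtain rfl | rfl := Int.units_eq_one_or δ <;>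
        simp only [Units.val_one, Units.val_neg] <;> lia
    refine ⟨c, ?_⟩
    have hcR := congrArg (Int.cast (R := ℝ)) hc
    push_cast at hcR
    rw [RootPairing.root', hr, Units.smul_def, Units.smul_def, map_add, map_zsmul, map_zsmul,
      LinearMap.add_apply, LinearMap.smul_apply, LinearMap.smul_apply, hxe, hxe, zsmul_eq_mul,
      zsmul_eq_mul]
    linarith
  refine ⟨⟨x, hmem⟩, funext fun i => ?_⟩
  rw [← @Int.cast_inj ℝ, coe_doubledCoords, hxe, mul_div_cancel₀ _ two_ne_zero]

theorem exists_residues_eq {y : κ → ZMod (2 * q)}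
    (hy : ∀ i j, parity q (y i) = parity q (y j)) : ∃ x, residues hroots.ge q x = y := by
  choose v hv using fun i => ZMod.intCast_surjective (y i)
  obtain ⟨x, rfl⟩ := exists_doubledCoords_eq hroots hB (v := v) fun i j => by
    have h := hy j i
    rw [← hv i, ← hv j, map_intCast, map_intCast, ZMod.intCast_eq_intCast_iff_dvd_sub] at h
    exact_mod_cast h
  exact ⟨x, funext hv⟩

theorem ker_residues_le : (residues hroots.ge q).ker ≤ multiples P q := by
  intro x hx
  choose c hc using fun i =>
    (ZMod.intCast_zmod_eq_zero_iff_dvd (doubledCoords hroots.ge x i) _).1 (congrFun hx i)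
  obtain ⟨z, hz⟩ := exists_doubledCoords_eq hroots hB (v := fun i => 2 * c i)
    fun i j => ⟨c i - c j, by ring⟩
  refine ⟨z, doubledCoords_injective hroots hB (funext fun i => ?_)⟩
  rw [nsmulAddMonoidHom_apply, map_nsmul, hz, hc i, Pi.smul_apply, nsmul_eq_mul]
  push_cast
  ring

theorem mem_map_residues_multiples_iff {y : κ → ZMod (2 * q)} :
    y ∈ (multiples P q).map (residues hroots.ge q) ↔ y = 0 ∨ y = fun _ => (q : ZMod (2 * q)) := by
  have hres (z : coweightLattice P) (i : κ) : residues hroots.ge q (q • z) i =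
      q * (doubledCoords hroots.ge z i : ℤ) := by
    rw [map_nsmul, Pi.smul_apply, nsmul_eq_mul]
    rfl
  constructor
  · rintro ⟨_, ⟨z, rfl⟩, rfl⟩
    obtain ⟨i₀⟩ : Nonempty κ := inferInstance
    choose c hc using fun i => two_dvd_doubledCoords_sub hroots.ge z i i₀
    have hconst (i : κ) : residues hroots.ge q (q • z) i =
        q * (doubledCoords hroots.ge z i₀ : ℤ) := by
      rw [hres, sub_eq_iff_eq_add.1 (hc i)]
      push_cast
      linear_combination (c i : ZMod (2 * q)) * natCast_add_self q
    obtain ⟨d, hd | hd⟩ := Int.even_or_odd' (doubledCoords hroots.ge z i₀)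
    · refine Or.inl (funext fun i => (?_ : residues hroots.ge q (q • z) i = 0))
      rw [hconst, hd]
      push_cast
      linear_combination (d : ZMod (2 * q)) * natCast_add_self q
    · refine Or.inr (funext fun i => (?_ : residues hroots.ge q (q • z) i = q))
      rw [hconst, hd]
      push_cast
      linear_combination (d : ZMod (2 * q)) * natCast_add_self q
  · rintro (rfl | rfl)
    · exact zero_mem _
    · obtain ⟨z, hz⟩ := exists_doubledCoords_eq hroots hB (v := 1) fun _ _ => by simp
      exact ⟨q • z, ⟨z, rfl⟩, funext fun i => by simp [hres, hz]⟩

theorem natCard_map_residues_multiples [NeZero q] :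
    Nat.card ((multiples P q).map (residues hroots.ge q)) = 2 := by
  have h : ((multiples P q).map (residues hroots.ge q) : Set (κ → ZMod (2 * q))) =
      {0, fun _ => (q : ZMod (2 * q))} :=
    Set.ext fun y => mem_map_residues_multiples_iff hroots hB
  rw [← SetLike.coe_sort_coe, h, Nat.card_coe_set_eq, Set.ncard_pair]
  obtain ⟨i₀⟩ : Nonempty κ := inferInstance
  exact fun h0 => natCast_ne_zero q (congrFun h0 i₀).symm

theorem modAct_mk_eq_self_iff {w : P.weylGroup} {σ : Equiv.Perm κ} {ε : κ → ℤˣ}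
    (hw : ActsSigned e w⁻¹ σ ε) (x : coweightLattice P) :
    modAct P q w x = x ↔
      (∀ i, ε i • residues hroots.ge q x (σ i) = residues hroots.ge q x i) ∨
        ∀ i, ε i • residues hroots.ge q x (σ i) = residues hroots.ge q x i + q := by
  have hmk : modAct P q w x = x ↔
      residues hroots.ge q (-x + w • x) ∈ (multiples P q).map (residues hroots.ge q) := by
    rw [← AddSubgroup.mem_comap, AddSubgroup.comap_map_eq_self (ker_residues_le hroots hB),
      eq_comm]
    exact QuotientAddGroup.eq
  rw [hmk, mem_map_residues_multiples_iff hroots hB]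
  simp only [map_add, map_neg, funext_iff, Pi.add_apply,
    residues_smul hroots.ge hw, neg_add_eq_iff_eq_add, add_zero]

theorem two_mul_equivChar [NeZero q] {w : P.weylGroup} {σ : Equiv.Perm κ} {ε : κ → ℤˣ}
    (hw : ActsSigned e w⁻¹ σ ε) :
    2 * equivChar P q w = Nat.card (shiftFixedTuples q σ ε) := by
  let F : Set (LatticeMod P q) := {y | y ∈ complement P q ∧ modAct P q w y = y}
  have hF : Nat.card (MulAction.fixedBy (complement P q) w) = Nat.card F :=
    Nat.card_congr <| (Equiv.subtypeEquivRight fun _ => Subtype.ext_iff).trans <|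
      Equiv.subtypeSubtypeEquivSubtypeInter (· ∈ complement P q) fun y => modAct P q w y = y
  have himage : residues hroots.ge q '' (QuotientAddGroup.mk ⁻¹' F) = shiftFixedTuples q σ ε := by
    ext y
    constructor
    · rintro ⟨x, ⟨hx, hwx⟩, rfl⟩
      exact ⟨(residues_mem_admissibleTuples_iff hroots x).2 hx,
        (modAct_mk_eq_self_iff hroots hB hw x).1 hwx⟩
    · rintro ⟨hy, hwy⟩
      obtain ⟨x, rfl⟩ := exists_residues_eq hroots hB hy.1
      exact ⟨x, ⟨(residues_mem_admissibleTuples_iff hroots x).1 hy,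
        (modAct_mk_eq_self_iff hroots hB hw x).2 hwy⟩, rfl⟩
  rw [equivChar, permCharacter, hF, ← himage,
    natCard_image_preimage_mk _ (ker_residues_le hroots hB),
    natCard_map_residues_multiples hroots hB, mul_comm]

end FixedClasses

section Reindexing

variable {κ κ' : Type*} {q : ℕ}

theorem natCard_shiftFixedTuples_permCongr (φ : κ ≃ κ') (σ : Equiv.Perm κ) (ε : κ' → ℤˣ) :
    Nat.card (shiftFixedTuples q (φ.permCongr σ) ε) =
      Nat.card (shiftFixedTuples q σ (ε ∘ φ)) := by
  refine Nat.card_congr ((φ.arrowCongr (Equiv.refl _)).symm.subtypeEquiv fun y => ?_)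
  simp only [shiftFixedTuples, admissibleTuples, Pairwise, Set.mem_ofPred_eq, φ.surjective.forall,
    φ.injective.ne_iff, Equiv.permCongr_apply, Equiv.symm_apply_apply]
  rfl

theorem natCard_shiftFixedTuples_revPerm {n m : ℕ} (hn : n = m + m) :
    Nat.card (shiftFixedTuples q (Fin.revPerm : Equiv.Perm (Fin n)) (-1)) =
      Nat.card (shiftFixedTuples q (Equiv.sumComm (Fin m) (Fin m)) (-1)) := by
  subst hn
  let φ : Fin m ⊕ Fin m ≃ Fin (m + m) :=
    ((Equiv.refl (Fin m)).sumCongr Fin.revPerm).trans finSumFinEquiv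
  have hφ : φ.permCongr (Equiv.sumComm (Fin m) (Fin m)) = Fin.revPerm := by
    refine Equiv.ext (φ.surjective.forall.2 ?_)
    rintro (i | i) <;> rw [Equiv.permCongr_apply, Equiv.symm_apply_apply] <;>
      refine Fin.ext ?_ <;> simp [φ] <;> omega
  rw [← hφ, natCard_shiftFixedTuples_permCongr]
  rfl

theorem cartanMatrix_submatrix_swap_last (n : ℕ) :
    (CartanMatrix.D (n + 2)).submatrix (Equiv.swap (Fin.last n).castSucc (Fin.last _))
      (Equiv.swap (Fin.last n).castSucc (Fin.last _)) = CartanMatrix.D (n + 2) := by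
  let σ := Equiv.swap (Fin.last n).castSucc (Fin.last (n + 1))
  have hcases (i : Fin (n + 2)) : (∃ k : Fin n, i = k.castSucc.castSucc ∧ σ i = i) ∨
      (i = (Fin.last n).castSucc ∧ σ i = Fin.last _) ∨
        (i = Fin.last _ ∧ σ i = (Fin.last n).castSucc) := by
    obtain rfl | hlast := eq_or_ne i (Fin.last _)
    · exact Or.inr (Or.inr ⟨rfl, Equiv.swap_apply_right _ _⟩)
    obtain rfl | hpenultimate := eq_or_ne i (Fin.last n).castSucc
    · exact Or.inr (Or.inl ⟨rfl, Equiv.swap_apply_left _ _⟩)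
    obtain ⟨i, rfl⟩ := Fin.exists_castSucc_eq.2 hlast
    obtain ⟨i, rfl⟩ := Fin.exists_castSucc_eq.2 (ne_of_apply_ne _ hpenultimate)
    exact Or.inl ⟨i, rfl, Equiv.swap_apply_of_ne_of_ne hpenultimate hlast⟩
  ext i j
  change CartanMatrix.D _ (σ i) (σ j) = _
  obtain ⟨i, rfl, hi⟩ | ⟨rfl, hi⟩ | ⟨rfl, hi⟩ := hcases i <;>
    obtain ⟨j, rfl, hj⟩ | ⟨rfl, hj⟩ | ⟨rfl, hj⟩ := hcases j <;>
    simp only [hi, hj] <;> simp [CartanMatrix.D, Fin.ext_iff] <;> grind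

end Reindexing

section CharacterValues

variable {ι M N : Type*} [AddCommGroup M] [Module ℝ M] [AddCommGroup N] [Module ℝ N]
  {P : RootPairing ι ℝ M N} [P.IsCrystallographic] {b : P.Base}

theorem IsLabellingD.swap_last {n : ℕ} {α : Fin (n + 2) ≃ b.support}
    (hD : IsLabellingD b (n + 2) α) :
    IsLabellingD b (n + 2) ((Equiv.swap (Fin.last n).castSucc (Fin.last _)).trans α) :=
  fun i j => (hD _ _).trans (congr_fun₂ (cartanMatrix_submatrix_swap_last n) i j)

theorem IsLabellingD.exists_last_eq {n : ℕ} {α : Fin (n + 2) ≃ b.support}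
    (hD : IsLabellingD b (n + 2) α) {j : Fin (n + 2)} (hj : n ≤ j) :
    ∃ α', IsLabellingD b (n + 2) α' ∧ α' (Fin.last _) = α j := by
  obtain rfl | hlast := eq_or_ne j (Fin.last _)
  · exact ⟨α, hD, rfl⟩
  obtain ⟨j, rfl⟩ := Fin.exists_castSucc_eq.2 hlast
  obtain rfl : j = Fin.last n := Fin.last_le_iff.1 hj
  refine ⟨_, hD.swap_last, ?_⟩
  rw [Equiv.trans_apply, Equiv.swap_apply_right]

variable [Finite ι] [P.IsReduced] [P.IsRootSystem] {q : ℕ} [NeZero q]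

section Labelled

variable {n : ℕ} {α : Fin (n + 2) ≃ b.support} (hD : IsLabellingD b (n + 2) α)
include hD

theorem two_mul_equivChar_one :
    2 * equivChar P q 1 = Nat.card (shiftFixedTuples q (1 : Equiv.Perm (Fin (n + 2))) 1) := by
  obtain ⟨e, he⟩ := exists_isFrameD fun k => P.root (α k)
  obtain ⟨B, hB⟩ := exists_basis_eq_frame he
  exact two_mul_equivChar (range_root_eq_typeDVectors hD he) hB fun i => by simp

theorem two_mul_equivChar_omega_zero (hn : Even n) (hn0 : n ≠ 0) :
    2 * equivChar P q (omega b (α 0)) =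
      Nat.card (shiftFixedTuples q 1 (negPair 0 (Fin.last (n + 1)))) := by
  obtain ⟨e, he⟩ := exists_isFrameD fun k => P.root (α k)
  obtain ⟨B, hB⟩ := exists_basis_eq_frame he
  exact two_mul_equivChar (range_root_eq_typeDVectors hD he) hB
    (actsSigned_omega_zero_inv hD he hn hn0)

theorem equivChar_one_of_odd (hq : ¬ 2 ∣ q) :
    (equivChar P q 1 : ℚ) =
      (∏ k ∈ Finset.range (n + 1), ((q : ℚ) - (2 * k + 1))) * (q - (n + 1)) := by
  refine mul_left_cancel₀ two_ne_zero ?_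
  rw [← card_shiftFixedTuples_one_of_odd hq (Fintype.card_fin (n + 2)), ← two_mul_equivChar_one hD]
  push_cast
  rfl

theorem equivChar_one_of_even (hq : 2 ∣ q) :
    (equivChar P q 1 : ℚ) = (∏ k ∈ Finset.range n, ((q : ℚ) - 2 * (k + 1))) *
      (q ^ 2 - 2 * (n + 1) * q + (n + 2) * (n + 1) / 2) := by
  refine mul_left_cancel₀ two_ne_zero ?_
  rw [← card_shiftFixedTuples_one_of_even hq (Fintype.card_fin (n + 2)),
    ← two_mul_equivChar_one hD]
  push_cast
  rfl

theorem equivChar_omega_zero_of_odd (hn : Even n) (hn0 : n ≠ 0) (hq : ¬ 2 ∣ q) :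
    equivChar P q (omega b (α 0)) = 0 := by
  refine (mul_eq_zero_iff_left two_ne_zero).1 ?_
  rw [two_mul_equivChar_omega_zero hD hn hn0]
  exact card_shiftFixedTuples_negPair_of_odd hq (Fin.last_pos).ne (by simpa using hn0.bot_lt)

theorem equivChar_omega_zero_of_even (hn : Even n) (hn0 : n ≠ 0) (hq : 2 ∣ q) :
    (equivChar P q (omega b (α 0)) : ℚ) = ∏ k ∈ Finset.range n, ((q : ℚ) - 2 * (k + 1)) := by
  refine mul_left_cancel₀ two_ne_zero ?_
  rw [← card_shiftFixedTuples_negPair_of_even hq (Fin.last_pos).ne (Fintype.card_fin (n + 2)) hn0,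
    ← two_mul_equivChar_omega_zero hD hn hn0]
  push_cast
  rfl

end Labelled

section LastNode

variable {m : ℕ} {α : Fin (2 * m + 2) ≃ b.support} (hD : IsLabellingD b (2 * m + 2) α)
include hD

theorem two_mul_equivChar_omega_last :
    2 * equivChar P q (omega b (α (Fin.last _))) =
      Nat.card (shiftFixedTuples q (Equiv.sumComm (Fin (m + 1)) (Fin (m + 1))) (-1)) := by
  obtain ⟨e, he⟩ := exists_isFrameD fun k => P.root (α k)
  obtain ⟨B, hB⟩ := exists_basis_eq_frame he
  rw [two_mul_equivChar (range_root_eq_typeDVectors hD he) hB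
    (actsSigned_omega_last_inv hD he (even_two_mul m)),
    natCard_shiftFixedTuples_revPerm (m := m + 1) (by omega)]

theorem equivChar_omega_last_of_odd (hq : ¬ 2 ∣ q) :
    equivChar P q (omega b (α (Fin.last _))) = 0 := by
  refine (mul_eq_zero_iff_left two_ne_zero).1 ?_
  rw [two_mul_equivChar_omega_last hD, card_shiftFixedTuples_sumComm_of_odd hq]

theorem equivChar_omega_last_of_even_of_not_four_dvd (hq : 2 ∣ q) (hq4 : ¬ 4 ∣ q) :
    (equivChar P q (omega b (α (Fin.last _))) : ℚ) =
      (∏ k ∈ Finset.range m, ((q : ℚ) - (4 * k + 2))) * (q - (3 * m + 1)) := by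
  refine mul_left_cancel₀ two_ne_zero ?_
  rw [← card_shiftFixedTuples_sumComm_of_even_of_not_four_dvd hq hq4 (Fintype.card_fin (m + 1)),
    ← two_mul_equivChar_omega_last hD]
  push_cast
  rfl

theorem equivChar_omega_last_of_four_dvd (hq : 4 ∣ q) :
    (equivChar P q (omega b (α (Fin.last _))) : ℚ) =
      (∏ k ∈ Finset.range m, ((q : ℚ) - 4 * (k + 1))) * (q - (m + 1)) := by
  refine mul_left_cancel₀ two_ne_zero ?_
  rw [← card_shiftFixedTuples_sumComm_of_four_dvd hq (Fintype.card_fin (m + 1)),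
    ← two_mul_equivChar_omega_last hD]
  push_cast
  rfl

end LastNode

theorem prod_Icc_one_eq_prod_range {R : Type*} [CommMonoid R] (f : ℕ → R) (m : ℕ) :
    ∏ k ∈ Finset.Icc 1 m, f k = ∏ k ∈ Finset.range m, f (k + 1) := by
  rw [Finset.range_eq_Ico, Finset.prod_Ico_add' f 0 m 1]
  rfl

end CharacterValues

end WeylChar

end

theorem mainTheorem9 {ι M N : Type*} [Finite ι] [AddCommGroup M] [Module ℝ M]
    [AddCommGroup N] [Module ℝ N]
    (P : RootPairing ι ℝ M N) [P.IsRootSystem] [P.IsCrystallographic] [P.IsReduced]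
    (b : P.Base) (ℓ : ℕ) (hℓ : 4 ≤ ℓ) (hev : Even ℓ)
    (α : Fin ℓ ≃ b.support) (hD : WeylChar.IsLabellingD b ℓ α)
    (q : ℕ) (hq : 0 < q) :
    -- `ω = 1`
    (¬ 2 ∣ q → (WeylChar.equivChar P q 1 : ℚ) =
      (∏ k ∈ Finset.Icc 1 (ℓ - 1), ((q : ℚ) - (2 * k - 1))) * (q - (ℓ - 1))) ∧
    (2 ∣ q → (WeylChar.equivChar P q 1 : ℚ) =
      (∏ k ∈ Finset.Icc 1 (ℓ - 2), ((q : ℚ) - 2 * k)) *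
        ((q : ℚ) ^ 2 - 2 * (ℓ - 1) * q + ℓ * (ℓ - 1) / 2)) ∧
    -- `ω = ω_1`
    (¬ 2 ∣ q → (WeylChar.equivChar P q (WeylChar.omega b (α ⟨0, by omega⟩)) : ℚ) = 0) ∧
    (2 ∣ q → (WeylChar.equivChar P q (WeylChar.omega b (α ⟨0, by omega⟩)) : ℚ) =
      ∏ k ∈ Finset.Icc 1 (ℓ - 2), ((q : ℚ) - 2 * k)) ∧
    -- `ω = ω_{ℓ-1}` (first index below) and `ω = ω_ℓ` (second index below)
    (∀ j : Fin ℓ, (j : ℕ) = ℓ - 2 ∨ (j : ℕ) = ℓ - 1 →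
      (Nat.gcd 4 q = 1 → (WeylChar.equivChar P q (WeylChar.omega b (α j)) : ℚ) = 0) ∧
      (Nat.gcd 4 q = 2 → (WeylChar.equivChar P q (WeylChar.omega b (α j)) : ℚ) =
        (∏ k ∈ Finset.Icc 1 (ℓ / 2 - 1), ((q : ℚ) - (4 * k - 2))) *
          (q - (3 * (ℓ : ℚ) / 2 - 2))) ∧
      (Nat.gcd 4 q = 4 → (WeylChar.equivChar P q (WeylChar.omega b (α j)) : ℚ) =
        (∏ k ∈ Finset.Icc 1 (ℓ / 2 - 1), ((q : ℚ) - 4 * k)) *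
          (q - (ℓ : ℚ) / 2))) := by
  have : NeZero q := ⟨hq.ne'⟩
  obtain ⟨m, rfl⟩ : ∃ m, ℓ = 2 * m + 2 := ⟨ℓ / 2 - 1, by have := hev.two_dvd; omega⟩
  have hm : 2 * m ≠ 0 := by omega
  simp only [Nat.add_sub_cancel, show 2 * m + 2 - 1 = 2 * m + 1 by omega,
    show (2 * m + 2) / 2 - 1 = m by omega, WeylChar.prod_Icc_one_eq_prod_range]
  refine ⟨fun h => ?_, fun h => ?_, fun h => ?_, fun h => ?_, fun j hj => ?_⟩
  · rw [WeylChar.equivChar_one_of_odd hD h]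
    push_cast
    ring_nf
  · rw [WeylChar.equivChar_one_of_even hD h]
    push_cast
    ring_nf
  · exact_mod_cast WeylChar.equivChar_omega_zero_of_odd hD (even_two_mul m) hm h
  · exact_mod_cast WeylChar.equivChar_omega_zero_of_even hD (even_two_mul m) hm h
  obtain ⟨α', hD', hj'⟩ := hD.exists_last_eq (j := j) (by omega)
  rw [← hj']
  refine ⟨fun h => ?_, fun h => ?_, fun h => ?_⟩
  · have hodd := Nat.prime_two.coprime_iff_not_dvd.1 (Nat.Coprime.coprime_dvd_left ⟨2, rfl⟩ h)
    exact_mod_cast WeylChar.equivChar_omega_last_of_odd hD' hodd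
  · have h4 : ¬ 4 ∣ q := fun h4 => by simp [Nat.gcd_eq_left h4] at h
    rw [WeylChar.equivChar_omega_last_of_even_of_not_four_dvd hD' (h ▸ Nat.gcd_dvd_right 4 q) h4]
    push_cast
    ring_nf
  · rw [WeylChar.equivChar_omega_last_of_four_dvd hD' (h ▸ Nat.gcd_dvd_right 4 q)]
    push_cast
    ring_nf
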